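/- Let $\Gamma$ be a discrete group with unit $e$ and let $\Delta\subseteq\Gamma$ be a positivity domain, i.e. $e\in\Delta$ and $\Delta^{-1}=\Delta$. Notation. Let $\mathrm{C}^*(\Gamma)$ be the universal group C$^*$-algebra, with canonical unitaries $\delta_s$, $s\in\Gamma$, and let $\mathrm{S}[\Delta]=\mathrm{span}\{\delta_s : s\in\Delta\}$. Let $\mathcal S(\Delta)$ be the family of finite sets $\Sigma\subseteq\Gamma$ with $\Sigma\Sigma^{-1}=\{st^{-1} : s,t\in\Sigma\}\subseteq\Delta$. An element of $\mathrm{M}_n(\mathrm{C}^*(\Gamma))$ is supported on a finite set $\Sigma\subseteq\Gamma$ if it is of the form $\sum_{s\in\Sigma}A_s\otimes\delta_s$ with $A_s\in\mathrm{M}_n(\mathbb C)$. Let $\mathcal U_n(\Delta)$ be the cone of all finite sums $\sum_{i=1}^r y_iy_i^*$, where each $y_i\in\mathrm{M}_n(\mathrm{C}^*(\Gamma))$ is supported on some $\Sigma_i\in\mathcal S(\Delta)$. Let $\mathrm{UOS}(\Delta)$ be the operator system $\mathrm{S}[\Delta]$ with unit $\delta_e$ and positive cones $\{x\in\mathrm{M}_n(\mathrm{S}[\Delta])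 : x+\epsilon\,\mathbf 1_n\otimes\delta_e\in\mathcal U_n(\Delta)\text{ for all }\epsilon>0\}$, $n\in\mathbb N$ (the Archimedeanisation of $(\mathrm{S}[\Delta],(\mathcal U_n(\Delta))_n,\delta_e)$). For a complex Hilbert space $H$, a function $u:\Delta\to\mathcal B(H)$ is positive semi-definite if $(u(st^{-1}))_{s,t\in\Sigma}$ is a positive operator on $\ell^2(\Sigma)\otimes H$ for every $\Sigma\in\mathcal S(\Delta)$; for $\Delta=\Gamma$ this is the usual notion. A positive semi-definite $u:\Delta\to\mathcal B(H)$ defines a completely positive map $\phi_u:\mathrm{UOS}(\Delta)\to\mathcal B(H)$ with $\phi_u(\delta_s)=u(s)$, $s\in\Delta$, and we set $\|u\|_{\mathrm B(\Delta,H)}:=\|\phi_u\|_{\mathrm{cb}}$. Likewise, a positive semi-definite $v:\Gamma\to\mathcal B(H)$ defines a completely positive map $\phi_v:\mathrm{C}^*(\Gamma)\to\mathcal B(H)$ with $\phi_v(\delta_s)=v(s)$, $s\in\Gamma$, and we set $\|v\|_{\mathrm B(\Gamma,H)}:=\|\phi_v\|_{\mathrm{cb}}$. Theorem. The following are equivalent: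 (i) (positive operator extension property) for every Hilbert space $H$ and every positive semi-definite function $u:\Delta\to\mathcal B(H)$ there is a positive semi-definite function $\tilde u:\Gamma\to\mathcal B(H)$ with $\tilde u|_\Delta=u$; (ii) (bounded operator extension property) for every Hilbert space $H$ and every positive semi-definite function $u:\Delta\to\mathcal B(H)$ there is a positive semi-definite function $\tilde u:\Gamma\to\mathcal B(H)$ with $\tilde u|_\Delta=u$ and $\|\tilde u\|_{\mathrm B(\Gamma,H)}=\|u\|_{\mathrm B(\Delta,H)}$; (iii) (complete factorisation property) for every $n\in\mathbb N$, every $z\in\mathrm{M}_n(\mathrm{C}^*(\Gamma))^+$ with finite support inside $\Delta$ and every $\epsilon>0$ there are $r\in\mathbb N$, sets $\Sigma_1,\dots,\Sigma_r\in\mathcal S(\Delta)$ and elements $y_i\in\mathrm{M}_n(\mathrm{C}^*(\Gamma))$ supported on $\Sigma_i$, $i=1,\dots,r$, such that $z+\epsilon\,\mathbf 1_n\otimes\delta_e=\sum_{i=1}^r y_iy_i^*$. -/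

import Mathlib

open scoped ENNReal

universe u v

noncomputable section

namespace PosDomain

/-! ## Positivity domains -/

/-- A positivity domain: a subset of a group that contains the unit and is closed under inverses. -/
structure IsPositivityDomain {Γ : Type u} [Group Γ] (Δ : Set Γ) : Prop where
  one_mem : (1 : Γ) ∈ Δ
  inv_mem : ∀ s ∈ Δ, s⁻¹ ∈ Δ

/-- The finite sets `F ⊆ Γ` with `F F⁻¹ ⊆ Δ`. -/
def IsAdmissible {Γ : Type u} [Group Γ] (Δ : Set Γ) (F : Finset Γ) : Prop :=
  ∀ s ∈ F, ∀ t ∈ F, s * t⁻¹ ∈ Δ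

/-! ## The universal group C⋆-algebra -/

/-- A unitary representation of the discrete group `Γ` on a nonzero complex Hilbert space.
Every cyclic representation of `Γ` is unitarily equivalent to one on a Hilbert space in the
universe of `Γ`. -/
structure UnitaryRep (Γ : Type u) [Group Γ] : Type (u + 1) where
  /-- the Hilbert space -/
  space : Type u
  [normed : NormedAddCommGroup space]
  [inner : InnerProductSpace ℂ space]
  [complete : CompleteSpace space]
  [nontrivial : Nontrivial space]
  /-- the representation -/
  rep : Γ →* unitary (space →L[ℂ] space)

attribute [instance] UnitaryRep.normed UnitaryRep.inner UnitaryRep.complete UnitaryRep.nontrivial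

/-- The C⋆-algebra of uniformly bounded families `(T_ρ)_ρ`, with `T_ρ` a bounded operator on the
space of `ρ`, where `ρ` runs over the unitary representations of `Γ`. -/
abbrev UnivProd (Γ : Type u) [Group Γ] : Type (u + 1) :=
  lp (fun ρ : UnitaryRep Γ => (ρ.space →L[ℂ] ρ.space)) ∞

/-- The universal representation `s ↦ (ρ(s))_ρ`. -/
def univRep {Γ : Type u} [Group Γ] (s : Γ) : UnivProd Γ :=
  ⟨fun ρ => (ρ.rep s : ρ.space →L[ℂ] ρ.space), memℓp_infty ⟨1, by
    rintro _ ⟨ρ, rfl⟩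
    exact (CStarRing.norm_coe_unitary (ρ.rep s)).le⟩⟩

instance instCStarAlgebraUnivProd (Γ : Type u) [Group Γ] : CStarAlgebra (UnivProd Γ) where

/-- The closed ⋆-subalgebra generated by the image of the universal representation. -/
def groupCStarSubalgebra (Γ : Type u) [Group Γ] : StarSubalgebra ℂ (UnivProd Γ) :=
  (StarAlgebra.adjoin ℂ (Set.range (univRep (Γ := Γ)))).topologicalClosure

instance instIsClosedGroupCStar (Γ : Type u) [Group Γ] :
    IsClosed (groupCStarSubalgebra Γ : Set (UnivProd Γ)) :=
  StarSubalgebra.isClosed_topologicalClosure _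

/-- `C⋆(Γ)`: the C⋆-algebra generated by the image of the universal representation, that is, the
completion of the group algebra for the norm `‖x‖ = sup_ρ ‖ρ(x)‖`. -/
def GroupCStar (Γ : Type u) [Group Γ] : Type (u + 1) :=
  groupCStarSubalgebra Γ

/-- The C⋆-algebra structure of `C⋆(Γ)`, as a closed ⋆-subalgebra. -/
def cstarAlgebraGroupCStar (Γ : Type u) [Group Γ] : CStarAlgebra (GroupCStar Γ) :=
  StarSubalgebra.cstarAlgebra (groupCStarSubalgebra Γ)

instance instCStarAlgebraGroupCStar (Γ : Type u) [Group Γ] : CStarAlgebra (GroupCStar Γ) :=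
  cstarAlgebraGroupCStar Γ

instance instPartialOrderGroupCStar (Γ : Type u) [Group Γ] : PartialOrder (GroupCStar Γ) :=
  CStarAlgebra.spectralOrder _

instance instStarOrderedRingGroupCStar (Γ : Type u) [Group Γ] : StarOrderedRing (GroupCStar Γ) :=
  CStarAlgebra.spectralOrderedRing _

/-- The canonical unitary generators `δ_s` of `C⋆(Γ)`. -/
def delta {Γ : Type u} [Group Γ] (s : Γ) : GroupCStar Γ :=
  ⟨univRep s, StarSubalgebra.le_topologicalClosure _
    (StarAlgebra.subset_adjoin ℂ _ ⟨s, rfl⟩)⟩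

/-! ## Matrices over `C⋆(Γ)` and sums of squares -/

/-- The C⋆-algebra `M_m(C⋆(Γ))`, with its C⋆-norm and its positive cone `{x | 0 ≤ x}`. -/
abbrev MatCStar (m : Type) (Γ : Type u) [Group Γ] : Type (u + 1) :=
  CStarMatrix m m (GroupCStar Γ)

/-- The element `A ⊗ δ_s` of `M_m(C⋆(Γ))`. -/
def tensorDelta {m : Type} {Γ : Type u} [Group Γ] (A : Matrix m m ℂ) (s : Γ) : MatCStar m Γ :=
  CStarMatrix.ofMatrix (A.map fun c => c • delta s)

/-- `x = ∑_{s ∈ F} A_s ⊗ δ_s` for some scalar matrices `A_s`. -/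
def SupportedOn {m : Type} {Γ : Type u} [Group Γ] (F : Finset Γ) (x : MatCStar m Γ) : Prop :=
  ∃ A : Γ → Matrix m m ℂ, x = ∑ s ∈ F, tensorDelta (A s) s

/-- `x = ∑_i y_i y_i⋆` is a finite sum of squares, each `y_i` being supported on a finite set `F_i`
with `F_i F_i⁻¹ ⊆ Δ`. -/
def IsSumOfSquares {m : Type} [Fintype m] {Γ : Type u} [Group Γ] (Δ : Set Γ)
    (x : MatCStar m Γ) : Prop :=
  ∃ (r : ℕ) (F : Fin r → Finset Γ) (y : Fin r → MatCStar m Γ),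
    (∀ i, IsAdmissible Δ (F i)) ∧ (∀ i, SupportedOn (F i) (y i)) ∧
      x = ∑ i, y i * star (y i)

/-- The complete factorisation property. -/
def HasCompleteFactorisation {Γ : Type u} [Group Γ] (Δ : Set Γ) : Prop :=
  ∀ (n : ℕ) (z : MatCStar (Fin n) Γ), 0 ≤ z →
    (∃ F : Finset Γ, (F : Set Γ) ⊆ Δ ∧ SupportedOn F z) →
      ∀ ε : ℝ, 0 < ε → IsSumOfSquares Δ (z + (ε : ℂ) • (1 : MatCStar (Fin n) Γ))

/-! ## Operator matrices and positive semi-definite functions -/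

section Operators

variable {H : Type v} [NormedAddCommGroup H] [InnerProductSpace ℂ H]

/-- The operator on the Hilbert space `ℓ²(m) ⊗ H = H^m` given by a matrix with entries in
`B(H)`. -/
def blockOperator {m : Type u} [Fintype m] (T : Matrix m m (H →L[ℂ] H)) :
    PiLp 2 (fun _ : m => H) →L[ℂ] PiLp 2 (fun _ : m => H) :=
  (PiLp.continuousLinearEquiv 2 ℂ (fun _ : m => H)).symm.toContinuousLinearMap ∘L
    ContinuousLinearMap.pi fun i => ∑ j, T i j ∘L PiLp.proj 2 (fun _ : m => H) j

@[simp]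
theorem blockOperator_apply {m : Type u} [Fintype m] (T : Matrix m m (H →L[ℂ] H))
    (ξ : PiLp 2 (fun _ : m => H)) (i : m) : blockOperator T ξ i = ∑ j, T i j (ξ j) := by
  simp [blockOperator]

/-- Positive semi-definite functions `Γ → B(H)`. -/
def IsPosSemidef {Γ : Type u} [Group Γ] (w : Γ → (H →L[ℂ] H)) : Prop :=
  ∀ F : Finset Γ,
    (blockOperator (Matrix.of fun s t : F => w ((s : Γ) * (t : Γ)⁻¹))).IsPositive

/-- Positive semi-definite functions `Δ → B(H)`. -/
def IsPosSemidefOn {Γ : Type u} [Group Γ] (Δ : Set Γ) (w : Δ → (H →L[ℂ] H)) : Prop :=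
  ∀ (F : Finset Γ) (hF : IsAdmissible Δ F),
    (blockOperator (Matrix.of fun s t : F =>
      w ⟨(s : Γ) * (t : Γ)⁻¹, hF s s.2 t t.2⟩)).IsPositive

/-! ## The norm of `B(Γ, H)` -/

/-- The completely bounded norm of a map `C⋆(Γ) → B(H)`. -/
def cbNorm {Γ : Type u} [Group Γ] (φ : GroupCStar Γ →L[ℂ] (H →L[ℂ] H)) : ℝ≥0∞ :=
  ⨆ (n : ℕ) (x : MatCStar (Fin n) Γ) (_ : ‖x‖ ≤ 1),
    ‖blockOperator (Matrix.of fun i j => φ (x i j))‖ₑ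

/-- The norm `‖w‖ = ‖φ_w‖_cb` of `B(Γ, H)`, where `φ_w : C⋆(Γ) → B(H)` is the bounded linear map
with `φ_w(δ_s) = w(s)`. There is at most one such map, because the `δ_s` span a dense subspace, so
the infimum is over at most one element (and is `∞` if `φ_w` does not exist). -/
def fsNorm {Γ : Type u} [Group Γ] (w : Γ → (H →L[ℂ] H)) : ℝ≥0∞ :=
  ⨅ (φ : GroupCStar Γ →L[ℂ] (H →L[ℂ] H)) (_ : ∀ s, φ (delta s) = w s), cbNorm φ

end Operators

/-! ## The operator system `UOS(Δ)` and the norm of `B(Δ, H)` -/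

/-- `S[Δ]`, the vector space with basis `(δ_s)_{s ∈ Δ}`. -/
abbrev SpanDelta {Γ : Type u} (Δ : Set Γ) : Type u := Δ →₀ ℂ

/-- The inclusion of `S[Δ]` in `C⋆(Γ)`. -/
def inclDelta {Γ : Type u} [Group Γ] (Δ : Set Γ) : SpanDelta Δ →ₗ[ℂ] GroupCStar Γ :=
  Finsupp.linearCombination ℂ fun s : Δ => delta (s : Γ)

/-- The positive cone of `M_m(UOS(Δ))`, as a subset of `M_m(C⋆(Γ))`. The positive cone of
`M_m(UOS₀(Δ))` is the set of all sums of squares of elements supported on admissible sets, and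
`UOS(Δ)` is the Archimedeanisation of `UOS₀(Δ)`. No quotient has to be taken, because the
restrictions of the states of `C⋆(Γ)` are states of `UOS₀(Δ)` and separate points. -/
def uosCone (m : Type) [Fintype m] [DecidableEq m] {Γ : Type u} [Group Γ] (Δ : Set Γ) :
    Set (MatCStar m Γ) :=
  {x | ∀ ε : ℝ, 0 < ε → IsSumOfSquares Δ (x + (ε : ℂ) • (1 : MatCStar m Γ))}

/-- The norm of `x ∈ M_n(X)` for the operator system `X = UOS(Δ)` with unit `e = δ_1`: the infimum
of the `r ≥ 0` such that the matrix with rows `(r e, x)` and `(x⋆, r e)` is positive in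
`M_{2n}(X)`. -/
def uosNorm {n : ℕ} {Γ : Type u} [Group Γ] {Δ : Set Γ}
    (x : Matrix (Fin n) (Fin n) (SpanDelta Δ)) : ℝ :=
  sInf {r : ℝ | 0 ≤ r ∧
    CStarMatrix.ofMatrix (Matrix.fromBlocks
      ((r : ℂ) • (1 : Matrix (Fin n) (Fin n) (GroupCStar Γ))) (x.map (inclDelta Δ))
      (x.map (inclDelta Δ)).conjTranspose
      ((r : ℂ) • (1 : Matrix (Fin n) (Fin n) (GroupCStar Γ)))) ∈ uosCone (Fin n ⊕ Fin n) Δ}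

section Extension

variable {H : Type v} [NormedAddCommGroup H] [InnerProductSpace ℂ H] [CompleteSpace H]

/-- The completely bounded norm of a map `UOS(Δ) → B(H)`. -/
def uosCbNorm {Γ : Type u} [Group Γ] {Δ : Set Γ} (φ : SpanDelta Δ →ₗ[ℂ] (H →L[ℂ] H)) : ℝ≥0∞ :=
  ⨆ (n : ℕ) (x : Matrix (Fin n) (Fin n) (SpanDelta Δ)) (_ : uosNorm x ≤ 1),
    ‖blockOperator (x.map φ)‖ₑ

/-- The norm `‖w‖ = ‖φ_w‖_cb` of `B(Δ, H)`, where `φ_w : UOS(Δ) → B(H)` is the linear map with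
`φ_w(δ_s) = w(s)` for `s ∈ Δ`. -/
def fsNormOn {Γ : Type u} [Group Γ] (Δ : Set Γ) (w : Δ → (H →L[ℂ] H)) : ℝ≥0∞ :=
  uosCbNorm (Finsupp.linearCombination ℂ w : SpanDelta Δ →ₗ[ℂ] (H →L[ℂ] H))

end Extension

/-- The positive operator extension property. -/
def HasPositiveOperatorExtension {Γ : Type u} [Group Γ] (Δ : Set Γ) : Prop :=
  ∀ (H : Type v) [NormedAddCommGroup H] [InnerProductSpace ℂ H] [CompleteSpace H]
    (w : Δ → (H →L[ℂ] H)), IsPosSemidefOn Δ w →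
      ∃ w' : Γ → (H →L[ℂ] H), IsPosSemidef w' ∧ ∀ s : Δ, w' s = w s

/-- The bounded operator extension property. -/
def HasBoundedOperatorExtension {Γ : Type u} [Group Γ] (Δ : Set Γ) : Prop :=
  ∀ (H : Type v) [NormedAddCommGroup H] [InnerProductSpace ℂ H] [CompleteSpace H]
    (w : Δ → (H →L[ℂ] H)), IsPosSemidefOn Δ w →
      ∃ w' : Γ → (H →L[ℂ] H), IsPosSemidef w' ∧ (∀ s : Δ, w' s = w s) ∧
        fsNorm w' = fsNormOn Δ w

end PosDomain

end

-- Positive semi-definite functions on `Γ` are exactly compressions V⋆ρ(·)V of unitary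
-- representations (`IsPosKernel.exists_dilation`, `isPosSemidef_compression`), and those on `Δ` are
-- dual to the sums of squares supported on admissible sets (`IsSumOfSquares.re_sum_nonneg`,
-- `isPosOn_functionalKernel`). The theorem compares two cones of matrices supported in `Δ`: those
-- positive in `C⋆(Γ)` and the sums of squares. Factorisation says that they agree up to ε;
-- extension is the dual statement.
--
-- (i) ⇔ (ii): both norms equal the norm of the value at the unit (`IsPosSemidef.fsNorm_eq`,
-- `IsPosSemidef.fsNormOn_eq`), so every positive extension automatically preserves the norm.
--
-- (iii) ⇒ (i): a function u on `Δ` defines the functional (s, x, y) ↦ ⟨x, u(s)y⟩ on finitely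
-- supported matrices indexed by all vectors of H. Factorisation makes its real part nonnegative on
-- the elements over `Δ` whose finite compressions have positive real part
-- (`operatorFunctional_nonneg`). The M. Riesz extension theorem extends it to all of `Γ`, and the
-- result is a positive kernel. As this kernel is already a bounded sesquilinear form at the unit,
-- its dilation comes from a bounded operator V. Indexing by every vector of H at once handles
-- infinite-dimensional H without a limit over finite-dimensional subspaces.
--
-- (i) ⇒ (iii): if z + ε1 is not a sum of squares, a real functional G with G(1) = 1, G ≥ 0 on sums
-- of squares and G(z + ε1) ≤ 0 separates it (`exists_separating_functional`). The matrix
-- coefficients of G form a positive semi-definite function on `Δ`; an extension to `Γ` integrates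
-- to a map that is nonnegative on z, whereas G(z) ≤ -ε. The separation is algebraic because the
-- unit is an order unit (`exists_isSumOfSquares_add`); no closedness of the cone is needed.

universe w

noncomputable section

namespace PosDomain

open scoped InnerProductSpace ComplexConjugate

/-! ## Dilation of positive semi-definite kernels -/

section Dilation

variable {Γ : Type u} [Group Γ] {ι : Type w}

/-- The sesquilinear form on finitely supported functions on `Γ × ι` given by a kernel. -/
def kernelForm (k : Γ → ι → ι → ℂ) (c d : Γ × ι →₀ ℂ) : ℂ :=
  c.sum fun p a => d.sum fun q b => conj a * b * k (p.1 * q.1⁻¹) p.2 q.2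

/-- Hermitian positive semi-definite matrix-valued functions on `Γ`, as scalar kernels. -/
structure IsPosKernel (k : Γ → ι → ι → ℂ) : Prop where
  herm : ∀ s i j, k s⁻¹ j i = conj (k s i j)
  nonneg : ∀ c : Γ × ι →₀ ℂ, 0 ≤ (kernelForm k c c).re

theorem kernelForm_add_left (k : Γ → ι → ι → ℂ) (c c' d : Γ × ι →₀ ℂ) :
    kernelForm k (c + c') d = kernelForm k c d + kernelForm k c' d := by
  classical
  unfold kernelForm
  refine Finsupp.sum_add_index' (fun p => by simp) (fun p a a' => ?_)
  rw [← Finsupp.sum_add]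
  simp [add_mul]

theorem kernelForm_smul_left (k : Γ → ι → ι → ℂ) (r : ℂ) (c d : Γ × ι →₀ ℂ) :
    kernelForm k (r • c) d = conj r * kernelForm k c d := by
  classical
  unfold kernelForm
  rw [Finsupp.sum_smul_index' (fun p => by simp), Finsupp.mul_sum]
  simp only [Finsupp.mul_sum, smul_eq_mul, map_mul, mul_assoc]

theorem kernelForm_conj_symm {k : Γ → ι → ι → ℂ} (hk : IsPosKernel k) (c d : Γ × ι →₀ ℂ) :
    conj (kernelForm k d c) = kernelForm k c d := by
  unfold kernelForm
  rw [Finsupp.sum_comm c d]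
  simp only [Finsupp.sum, map_sum, map_mul, RingHomCompTriple.comp_apply, RingHom.id_apply]
  refine Finset.sum_congr rfl fun p _ => Finset.sum_congr rfl fun q _ => ?_
  rw [← hk.herm, mul_inv_rev, inv_inv]
  ring

theorem kernelForm_single (k : Γ → ι → ι → ℂ) (p q : Γ × ι) (a b : ℂ) :
    kernelForm k (Finsupp.single p a) (Finsupp.single q b) =
      conj a * b * k (p.1 * q.1⁻¹) p.2 q.2 := by
  simp [kernelForm]

/-- The right translation by `g⁻¹` of finitely supported functions on `Γ × ι`. -/
def rightTranslate (g : Γ) : (Γ × ι →₀ ℂ) →ₗ[ℂ] (Γ × ι →₀ ℂ) :=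
  Finsupp.lmapDomain ℂ ℂ fun p => (p.1 * g⁻¹, p.2)

/-- The kernel depends on (p, q) only through pq⁻¹, which right translation fixes. This invariance
turns translation into the isometric action behind the dilation. -/
theorem kernelForm_rightTranslate (k : Γ → ι → ι → ℂ) (g : Γ) (c d : Γ × ι →₀ ℂ) :
    kernelForm k (rightTranslate g c) (rightTranslate g d) = kernelForm k c d := by
  classical
  unfold kernelForm rightTranslate
  simp only [Finsupp.lmapDomain_apply]
  rw [Finsupp.sum_mapDomain_index (by simp)]
  · refine Finsupp.sum_congr fun p _ => ?_
    rw [Finsupp.sum_mapDomain_index (by simp) (by intros; ring)]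
    simp
  · intro p a a'
    rw [← Finsupp.sum_add]
    simp [add_mul]

/-- Linear isometric actions of a group on a Hilbert space are unitary. -/
theorem mem_unitary_of_monoidHom {K : Type*} [NormedAddCommGroup K] [InnerProductSpace ℂ K]
    [CompleteSpace K] (R : Γ →* (K →L[ℂ] K)) (hR : ∀ g x, ‖R g x‖ = ‖x‖) (g : Γ) :
    R g ∈ unitary (K →L[ℂ] K) := by
  have h1 : star (R g) * R g = 1 := (ContinuousLinearMap.norm_map_iff_adjoint_comp_self _).1 (hR g)
  have h2 : R g * R g⁻¹ = 1 := by rw [← map_mul, mul_inv_cancel, map_one]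
  have h3 : star (R g) = R g⁻¹ := by
    calc star (R g) = star (R g) * (R g * R g⁻¹) := by rw [h2, mul_one]
      _ = R g⁻¹ := by rw [← mul_assoc, h1, one_mul]
  exact Unitary.mem_iff.2 ⟨h1, by rw [h3, h2]⟩

/-- Every positive semi-definite kernel is a family of coefficients of a unitary representation. -/
theorem IsPosKernel.exists_dilation {k : Γ → ι → ι → ℂ} (hk : IsPosKernel k) :
    ∃ (K : Type (max u w)) (_ : NormedAddCommGroup K) (_ : InnerProductSpace ℂ K)
      (_ : CompleteSpace K) (ρ : Γ →* unitary (K →L[ℂ] K)) (v : ι → K),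
      ∀ s i j, k s i j = ⟪v i, (ρ s : K →L[ℂ] K) (v j)⟫_ℂ := by
  classical
  let core : PreInnerProductSpace.Core ℂ (Γ × ι →₀ ℂ) :=
    { inner := kernelForm k
      conj_inner_symm := fun c d => kernelForm_conj_symm hk c d
      re_inner_nonneg := fun c => hk.nonneg c
      add_left := fun c c' d => kernelForm_add_left k c c' d
      smul_left := fun c d r => kernelForm_smul_left k r c d }
  let sn : SeminormedAddCommGroup (Γ × ι →₀ ℂ) :=
    InnerProductSpace.Core.toSeminormedAddCommGroup (𝕜 := ℂ)
  let ip : InnerProductSpace ℂ (Γ × ι →₀ ℂ) := InnerProductSpace.ofCore core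
  have inner_def : ∀ c d : Γ × ι →₀ ℂ, ⟪c, d⟫_ℂ = kernelForm k c d := fun c d => rfl
  have hT : ∀ (g : Γ) (c : Γ × ι →₀ ℂ), ‖rightTranslate g c‖ = ‖c‖ := fun g c => by
    rw [@norm_eq_sqrt_re_inner ℂ, @norm_eq_sqrt_re_inner ℂ _ _ _ _ c, inner_def, inner_def,
      kernelForm_rightTranslate]
  let T : Γ → (Γ × ι →₀ ℂ) →L[ℂ] (Γ × ι →₀ ℂ) := fun g =>
    (LinearIsometry.mk (rightTranslate g) (hT g)).toContinuousLinearMap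
  have hTapp : ∀ g c, T g c = rightTranslate g c := fun g c => rfl
  have hT1 : (T 1).completion = 1 := by
    ext x
    induction x using UniformSpace.Completion.induction_on with
    | hp => exact isClosed_eq (ContinuousLinearMap.continuous _) continuous_id
    | ih c =>
      rw [ContinuousLinearMap.completion_apply_coe, hTapp]
      simp only [rightTranslate, inv_one, mul_one, Prod.mk.eta, Finsupp.lmapDomain_apply]
      exact congrArg _ Finsupp.mapDomain_id
  have hTmul : ∀ g h, (T (g * h)).completion = (T g).completion * (T h).completion := fun g h => by
    ext x
    induction x using UniformSpace.Completion.induction_on with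
    | hp =>
      exact isClosed_eq (ContinuousLinearMap.continuous _) (ContinuousLinearMap.continuous _)
    | ih c =>
      rw [mul_apply_eq_comp]
      simp only [ContinuousLinearMap.completion_apply_coe, hTapp]
      congr 1
      simp only [rightTranslate, Finsupp.lmapDomain_apply, ← Finsupp.mapDomain_comp]
      congr 1
      funext p
      simp [mul_assoc]
  let R : Γ →* (UniformSpace.Completion (Γ × ι →₀ ℂ) →L[ℂ]
      UniformSpace.Completion (Γ × ι →₀ ℂ)) :=
    { toFun := fun g => (T g).completion, map_one' := hT1, map_mul' := hTmul }
  have hR : ∀ g x, ‖R g x‖ = ‖x‖ := fun g x => by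
    induction x using UniformSpace.Completion.induction_on with
    | hp => exact isClosed_eq (ContinuousLinearMap.continuous _).norm continuous_norm
    | ih c =>
      change ‖(T g).completion c‖ = _
      rw [ContinuousLinearMap.completion_apply_coe, UniformSpace.Completion.norm_coe,
        UniformSpace.Completion.norm_coe, hTapp, hT]
  -- The vector v i is the class of the point mass at (1, i); translation by s moves the mass at (1,
  -- j) to (s⁻¹, j), and 1 · (s⁻¹)⁻¹ = s recovers k(s, i, j).
  refine ⟨UniformSpace.Completion (Γ × ι →₀ ℂ), inferInstance, inferInstance, inferInstance,
    R.codRestrict (unitary _) (mem_unitary_of_monoidHom R hR),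
    fun i => ((Finsupp.single (1, i) 1 : Γ × ι →₀ ℂ) : UniformSpace.Completion (Γ × ι →₀ ℂ)),
    fun s i j => ?_⟩
  change _ = inner ℂ _ ((T s).completion _)
  rw [ContinuousLinearMap.completion_apply_coe, UniformSpace.Completion.inner_coe, inner_def,
    hTapp]
  simp [rightTranslate, kernelForm_single]

end Dilation

/-! ## The group C⋆-algebra and its representations -/

section GroupAlgebra

variable {Γ : Type u} [Group Γ]

theorem univRep_mul (s t : Γ) : univRep (s * t) = univRep s * univRep t := by
  refine lp.ext (funext fun ρ => ?_)
  simp [univRep]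

theorem univRep_one : univRep (1 : Γ) = 1 := by
  refine lp.ext (funext fun ρ => ?_)
  simp [univRep]

theorem star_univRep (s : Γ) : star (univRep s) = univRep s⁻¹ := by
  refine lp.ext (funext fun ρ => ?_)
  simp only [lp.star_apply, univRep, map_inv]
  rfl

theorem delta_mul (s t : Γ) : delta s * delta t = delta (s * t) :=
  Subtype.ext (univRep_mul s t).symm

theorem delta_one : delta (1 : Γ) = 1 :=
  Subtype.ext univRep_one

theorem star_delta (s : Γ) : star (delta s) = delta s⁻¹ :=
  Subtype.ext (star_univRep s)

/-- The representation of `C⋆(Γ)` integrating a unitary representation of `Γ`. -/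
def evalRep (ρ : UnitaryRep Γ) : GroupCStar Γ →⋆ₐ[ℂ] (ρ.space →L[ℂ] ρ.space) where
  toFun a := (show groupCStarSubalgebra Γ from a).1 ρ
  map_one' := rfl
  map_mul' _ _ := rfl
  map_zero' := rfl
  map_add' _ _ := rfl
  commutes' _ := rfl
  map_star' _ := rfl

theorem continuous_evalRep (ρ : UnitaryRep Γ) : Continuous (evalRep ρ) :=
  map_continuous (evalRep ρ)

/-- The inclusion of the group algebra in `C⋆(Γ)`. -/
def groupAlgebraIncl (Γ : Type u) [Group Γ] : (Γ →₀ ℂ) →ₗ[ℂ] GroupCStar Γ :=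
  Finsupp.linearCombination ℂ delta

theorem groupAlgebraIncl_single (s : Γ) (c : ℂ) :
    groupAlgebraIncl Γ (Finsupp.single s c) = c • delta s := by
  simp [groupAlgebraIncl]

theorem denseRange_groupAlgebraIncl : DenseRange (groupAlgebraIncl Γ) := by
  -- The span of the universal unitaries is already closed under products and adjoints, so it is the
  -- whole generated ⋆-algebra.
  have key : ∀ a ∈ StarAlgebra.adjoin ℂ (Set.range (univRep (Γ := Γ))),
      a ∈ Submodule.span ℂ (Set.range (univRep (Γ := Γ))) := by
    intro a ha
    induction ha using StarAlgebra.adjoin_induction with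
    | mem x hx => exact Submodule.subset_span hx
    | algebraMap r =>
      rw [Algebra.algebraMap_eq_smul_one, ← univRep_one]
      exact Submodule.smul_mem _ _ (Submodule.subset_span ⟨1, rfl⟩)
    | add x y _ _ hx hy => exact Submodule.add_mem _ hx hy
    | mul x y _ _ hx hy =>
      have h := Submodule.mul_mem_mul hx hy
      rw [Submodule.span_mul_span] at h
      refine Submodule.span_mono ?_ h
      rintro _ ⟨_, ⟨s, rfl⟩, _, ⟨t, rfl⟩, rfl⟩
      exact ⟨s * t, univRep_mul s t⟩
    | star x hxm hx =>
      clear hxm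
      induction hx using Submodule.span_induction with
      | mem x hx =>
        obtain ⟨s, rfl⟩ := hx
        exact Submodule.subset_span ⟨s⁻¹, (star_univRep s).symm⟩
      | zero => simp
      | add x y _ _ hx hy => rw [star_add]; exact Submodule.add_mem _ hx hy
      | smul r x _ hx => rw [star_smul]; exact Submodule.smul_mem _ _ hx
  intro a
  obtain ⟨a, ha⟩ := a
  refine (closure_subtype (X := UnivProd Γ) (p := (· ∈ groupCStarSubalgebra Γ)) (x := ⟨a, ha⟩)
    (s := (Set.range (groupAlgebraIncl Γ) : Set (groupCStarSubalgebra Γ)))).2 ?_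
  refine closure_mono ?_
    (show a ∈ closure (StarAlgebra.adjoin ℂ (Set.range (univRep (Γ := Γ))) : Set (UnivProd Γ))
      from ha)
  intro b hb
  have hb' := key b hb
  refine Submodule.span_induction (p := fun x _ => x ∈ Subtype.val ''
    (Set.range (groupAlgebraIncl Γ) : Set (groupCStarSubalgebra Γ))) ?_ ?_ ?_ ?_ hb'
  · rintro _ ⟨s, rfl⟩
    exact ⟨_, ⟨Finsupp.single s 1, rfl⟩, by rw [groupAlgebraIncl_single, one_smul]; rfl⟩
  · exact ⟨0, ⟨0, map_zero _⟩, rfl⟩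
  · rintro _ _ _ _ ⟨_, ⟨c, rfl⟩, rfl⟩ ⟨_, ⟨d, rfl⟩, rfl⟩
    exact ⟨_, ⟨c + d, map_add _ _ _⟩, rfl⟩
  · rintro r _ _ ⟨_, ⟨c, rfl⟩, rfl⟩
    exact ⟨_, ⟨r • c, map_smul _ _ _⟩, rfl⟩

/-- Two continuous linear maps on `C⋆(Γ)` that agree on the generators are equal. -/
theorem groupCStar_clm_ext {V : Type*} [NormedAddCommGroup V] [NormedSpace ℂ V]
    {φ ψ : GroupCStar Γ →L[ℂ] V} (h : ∀ s, φ (delta s) = ψ (delta s)) : φ = ψ := by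
  refine DFunLike.coe_injective
    (denseRange_groupAlgebraIncl.equalizer φ.continuous ψ.continuous (funext fun c => ?_))
  simp [groupAlgebraIncl, Finsupp.linearCombination_apply, Finsupp.sum, h]

/-- The trivial one-dimensional representation. -/
def trivialRep (Γ : Type u) [Group Γ] : UnitaryRep Γ where
  space := EuclideanSpace ℂ PUnit.{u + 1}
  rep := 1

/-- Scalar kernels with values in finite matrices dilate to representations of `C⋆(Γ)`. -/
theorem IsPosKernel.exists_evalRep {ι : Type} {k : Γ → ι → ι → ℂ} (hk : IsPosKernel k) :
    ∃ (ρ : UnitaryRep Γ) (v : ι → ρ.space),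
      ∀ s i j, k s i j = ⟪v i, evalRep ρ (delta s) (v j)⟫_ℂ := by
  obtain ⟨K, i1, i2, i3, ρ, v, h⟩ := hk.exists_dilation
  -- `UnitaryRep` demands a nonzero space. If the dilation space is zero, the kernel vanishes and
  -- zero vectors in the trivial representation serve.
  rcases subsingleton_or_nontrivial K with hK | hK
  · refine ⟨trivialRep Γ, fun _ => 0, fun s i j => ?_⟩
    rw [h, Subsingleton.elim (v i) 0, inner_zero_left, inner_zero_left]
  · exact ⟨{ space := K, rep := ρ }, v, h⟩

/-- The indicator function of the unit is a positive kernel. In its dilation the vector state is the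
canonical trace, and applying it to δ_{t⁻¹}x reads off the coefficient of x at t. -/
theorem linearIndependent_delta : LinearIndependent ℂ (delta : Γ → GroupCStar Γ) := by
  classical
  have hk : IsPosKernel (ι := Unit) fun (s : Γ) _ _ => if s = 1 then (1 : ℂ) else 0 := by
    refine ⟨fun s _ _ => ?_, fun c => ?_⟩
    · by_cases h : s = 1 <;> simp [h]
    · have : kernelForm (fun (s : Γ) (_ _ : Unit) => if s = 1 then (1 : ℂ) else 0) c c =
          c.sum fun p a => conj a * a := by
        refine Finset.sum_congr rfl fun p hp => ?_
        refine (Finset.sum_eq_single p (fun q _ hq => ?_) (fun h => absurd hp h)).trans (by simp)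
        have : ¬ p.1 * q.1⁻¹ = 1 := fun h => hq (Prod.ext (mul_inv_eq_one.1 h).symm rfl)
        simp [this]
      rw [this, Finsupp.sum, Complex.re_sum]
      refine Finset.sum_nonneg fun p _ => ?_
      rw [← Complex.normSq_eq_conj_mul_self]
      exact Complex.normSq_nonneg _
  obtain ⟨ρ, v, h⟩ := hk.exists_evalRep
  rw [linearIndependent_iff]
  intro c hc
  ext t
  have h1 : ⟪v (), evalRep ρ (delta t⁻¹ * Finsupp.linearCombination ℂ delta c) (v ())⟫_ℂ = c t := by
    rw [Finsupp.linearCombination_apply, Finsupp.sum, Finset.mul_sum, map_sum,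
      sum_apply, inner_sum]
    simp only [mul_smul_comm, map_smul, delta_mul, smul_apply, inner_smul_right,
      ← h]
    rw [Finset.sum_eq_single t]
    · simp
    · intro s _ hs
      simp [inv_mul_eq_one, Ne.symm hs]
    · simp
  rw [← h1, hc]
  simp

/-- Arbitrary values on the generators extend to a linear map on `C⋆(Γ)`. -/
theorem exists_linearMap_delta {V : Type*} [AddCommGroup V] [Module ℂ V] (g : Γ → V) :
    ∃ ψ : GroupCStar Γ →ₗ[ℂ] V, ∀ s, ψ (delta s) = g s := by
  obtain ⟨T, hT⟩ := LinearMap.exists_leftInverse_of_injective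
    (Finsupp.linearCombination ℂ (delta : Γ → GroupCStar Γ))
    (LinearMap.ker_eq_bot.2 linearIndependent_delta)
  refine ⟨Finsupp.linearCombination ℂ g ∘ₗ T, fun s => ?_⟩
  have := LinearMap.congr_fun hT (Finsupp.single s 1)
  simp only [LinearMap.comp_apply, Finsupp.linearCombination_single, one_smul,
    LinearMap.id_apply] at this
  simp [this]

end GroupAlgebra

/-! ## Matrices over a C⋆-algebra acting on a Hilbert space -/

section BlockHom

variable {N : Type} [Fintype N] {K : Type v} [NormedAddCommGroup K] [InnerProductSpace ℂ K]

theorem inner_blockOperator (T : Matrix N N (K →L[ℂ] K)) (ξ η : PiLp 2 (fun _ : N => K)) :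
    ⟪ξ, blockOperator T η⟫_ℂ = ∑ i, ∑ j, ⟪ξ i, T i j (η j)⟫_ℂ := by
  simp [PiLp.inner_apply, inner_sum]

variable [CompleteSpace K] [DecidableEq N] {A : Type w} [CStarAlgebra A]

/-- The representation of matrices over `A` on `K^N` induced by a representation of `A` on `K`. -/
def blockHom (N : Type) [Fintype N] [DecidableEq N] (π : A →⋆ₐ[ℂ] (K →L[ℂ] K)) :
    CStarMatrix N N A →⋆ₐ[ℂ] (PiLp 2 (fun _ : N => K) →L[ℂ] PiLp 2 (fun _ : N => K)) where
  toFun x := blockOperator (Matrix.of fun i j => π (x i j))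
  map_one' := by
    ext ξ i
    simp [CStarMatrix.one_apply, apply_ite π, ite_apply, apply_ite DFunLike.coe]
  map_mul' x y := by
    ext ξ i
    simp only [blockOperator_apply, Matrix.of_apply, CStarMatrix.mul_apply, map_sum, map_mul,
      sum_apply, mul_apply_eq_comp]
    exact Finset.sum_comm
  map_zero' := by
    ext ξ i
    simp
  map_add' x y := by
    ext ξ i
    simp [Finset.sum_add_distrib]
  commutes' r := by
    ext ξ i
    simp [CStarMatrix.algebraMap_apply, apply_ite π, ite_apply, apply_ite DFunLike.coe,
      Algebra.algebraMap_eq_smul_one]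
  map_star' x := by
    refine ((ContinuousLinearMap.eq_adjoint_iff _ _).2 fun ξ η => ?_)
    simp only [PiLp.inner_apply, blockOperator_apply, sum_inner, inner_sum, Matrix.of_apply,
      CStarMatrix.star_apply, map_star, ContinuousLinearMap.star_eq_adjoint,
      ContinuousLinearMap.adjoint_inner_left]
    exact Finset.sum_comm

theorem inner_blockHom (π : A →⋆ₐ[ℂ] (K →L[ℂ] K)) (x : CStarMatrix N N A)
    (ξ η : PiLp 2 (fun _ : N => K)) :
    ⟪ξ, blockHom N π x η⟫_ℂ = ∑ i, ∑ j, ⟪ξ i, π (x i j) (η j)⟫_ℂ :=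
  inner_blockOperator _ ξ η

theorem norm_blockHom_le [PartialOrder A] [StarOrderedRing A] (π : A →⋆ₐ[ℂ] (K →L[ℂ] K))
    (x : CStarMatrix N N A) : ‖blockHom N π x‖ ≤ ‖x‖ :=
  NonUnitalStarAlgHom.norm_apply_le (blockHom N π) x

end BlockHom

section

open scoped ComplexOrder

/-! ## Positive semi-definite functions and their completely positive maps -/

section PosSemidef

variable {Γ : Type u} [Group Γ] {H : Type v} [NormedAddCommGroup H] [InnerProductSpace ℂ H]

theorem isPositive_blockOperator_iff {m : Type w} [Fintype m] (T : Matrix m m (H →L[ℂ] H)) :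
    (blockOperator T).IsPositive ↔ ∀ ξ : m → H, 0 ≤ ∑ i, ∑ j, ⟪ξ i, T i j (ξ j)⟫_ℂ := by
  have key : ∀ ξ : PiLp 2 (fun _ : m => H),
      ⟪blockOperator T ξ, ξ⟫_ℂ = conj (∑ i, ∑ j, ⟪ξ i, T i j (ξ j)⟫_ℂ) := fun ξ => by
    simp [PiLp.inner_apply, sum_inner]
  have aux : ∀ z : ℂ, (((conj z).re : ℂ) = conj z ∧ 0 ≤ (conj z).re) ↔ 0 ≤ z := fun z => by
    simp [Complex.ext_iff, Complex.nonneg_iff, and_comm, eq_comm]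
  rw [ContinuousLinearMap.isPositive_iff_complex]
  refine ⟨fun h ξ => (aux _).1 ?_, fun h ξ => ?_⟩
  · have := h (WithLp.toLp 2 ξ)
    rwa [key] at this
  · rw [key]
    exact (aux _).2 (h ξ)

/-- The restriction to `Δ` of `g : Γ → B(H)` is positive semi-definite, in terms of the quadratic
forms on finitely supported functions. -/
structure IsPosOn (Δ : Set Γ) (g : Γ → (H →L[ℂ] H)) : Prop where
  herm : ∀ s ∈ Δ, ∀ x y, ⟪g s⁻¹ x, y⟫_ℂ = ⟪x, g s y⟫_ℂ
  nonneg : ∀ F : Finset Γ, IsAdmissible Δ F → ∀ ξ : Γ → H,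
    0 ≤ (∑ s ∈ F, ∑ t ∈ F, ⟪ξ s, g (s * t⁻¹) (ξ t)⟫_ℂ).re

/-- The quotients of {1, s} are 1, s and s⁻¹. These pairs give both Hermitian symmetry on `Δ` and
the order unit property. -/
theorem isAdmissible_pair [DecidableEq Γ] {Δ : Set Γ} (hΔ : IsPositivityDomain Δ) {s : Γ}
    (hs : s ∈ Δ) : IsAdmissible Δ {1, s} := by
  intro a ha b hb
  rw [Finset.mem_insert, Finset.mem_singleton] at ha hb
  rcases ha with rfl | rfl <;> rcases hb with rfl | rfl <;>
    simp [hΔ.one_mem, hs, hΔ.inv_mem]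

/-- Hermitian symmetry at s is the symmetry of the block operator on {1, s}, tested on vectors
concentrated at s and at 1. -/
theorem isPosOn_of_isPositive {Δ : Set Γ} (hΔ : IsPositivityDomain Δ) {g : Γ → (H →L[ℂ] H)}
    (hg : ∀ F : Finset Γ, IsAdmissible Δ F →
      (blockOperator (Matrix.of fun s t : F => g ((s : Γ) * (t : Γ)⁻¹))).IsPositive) :
    IsPosOn Δ g := by
  classical
  refine ⟨fun s hs x y => ?_, fun F hF ξ => ?_⟩
  · have h := (hg _ (isAdmissible_pair hΔ hs)).isSymmetric
      (WithLp.toLp 2 (Pi.single ⟨s, by simp⟩ x)) (WithLp.toLp 2 (Pi.single ⟨1, by simp⟩ y))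
    simp only [ContinuousLinearMap.coe_coe, PiLp.inner_apply, blockOperator_apply] at h
    rw [Finset.sum_eq_single ⟨1, by simp⟩ (fun i _ hi => by simp [hi]) (by simp),
      Finset.sum_eq_single ⟨s, by simp⟩ (fun i _ hi => by simp [hi]) (by simp),
      Finset.sum_eq_single ⟨s, by simp⟩ (fun i _ hi => by simp [hi]) (by simp),
      Finset.sum_eq_single ⟨1, by simp⟩ (fun i _ hi => by simp [hi]) (by simp)] at h
    simpa using h
  · have h := (Complex.nonneg_iff.1 ((isPositive_blockOperator_iff _).1 (hg F hF) fun s => ξ s)).1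
    simp only [Matrix.of_apply] at h
    rw [← Finset.sum_coe_sort F]
    simp only [← Finset.sum_coe_sort F]
    exact h

theorem IsPosOn.isPositive {Δ : Set Γ} {g : Γ → (H →L[ℂ] H)} (hg : IsPosOn Δ g) {F : Finset Γ}
    (hF : IsAdmissible Δ F) :
    (blockOperator (Matrix.of fun s t : F => g ((s : Γ) * (t : Γ)⁻¹))).IsPositive := by
  classical
  refine (isPositive_blockOperator_iff _).2 fun ξ => Complex.nonneg_iff.2 ⟨?_, ?_⟩
  · have h := hg.nonneg F hF fun s => if hs : s ∈ F then ξ ⟨s, hs⟩ else 0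
    rw [← Finset.sum_coe_sort F] at h
    simp only [← Finset.sum_coe_sort F] at h
    simpa using h
  · refine (Complex.conj_eq_iff_im.1 ?_).symm
    simp only [map_sum, inner_conj_symm, Matrix.of_apply]
    rw [Finset.sum_comm]
    refine Finset.sum_congr rfl fun s _ => Finset.sum_congr rfl fun t _ => ?_
    rw [← hg.herm _ (hF s s.2 t t.2), mul_inv_rev, inv_inv]

theorem isPosOn_univ_iff {g : Γ → (H →L[ℂ] H)} : IsPosOn Set.univ g ↔ IsPosSemidef g :=
  ⟨fun h _ => h.isPositive fun _ _ _ _ => trivial,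
    fun h => isPosOn_of_isPositive ⟨Set.mem_univ _, fun _ _ => Set.mem_univ _⟩ fun F _ => h F⟩

theorem isPosSemidefOn_iff {Δ : Set Γ} (hΔ : IsPositivityDomain Δ) {w : Δ → (H →L[ℂ] H)}
    {g : Γ → (H →L[ℂ] H)} (hgw : ∀ s : Δ, g s = w s) : IsPosSemidefOn Δ w ↔ IsPosOn Δ g := by
  have key : ∀ (F : Finset Γ) (hF : IsAdmissible Δ F),
      (Matrix.of fun s t : F => w ⟨(s : Γ) * (t : Γ)⁻¹, hF s s.2 t t.2⟩) =
        Matrix.of fun s t : F => g ((s : Γ) * (t : Γ)⁻¹) := fun F hF => by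
    refine Matrix.ext fun s t => ?_
    exact (hgw ⟨_, hF s s.2 t t.2⟩).symm
  refine ⟨fun h => isPosOn_of_isPositive hΔ fun F hF => ?_, fun h F hF => ?_⟩
  · rw [← key F hF]
    exact h F hF
  · rw [key F hF]
    exact h.isPositive hF

/-- Grouping the support of c by group element replaces it by the H-valued family ξ(s) = ∑ c(s, i)
b(i), on which the operator condition applies. The family b is arbitrary. -/
theorem IsPosSemidef.isPosKernel {w : Γ → (H →L[ℂ] H)} (hw : IsPosSemidef w) {ι : Type*}
    (b : ι → H) : IsPosKernel fun s i j => ⟪b i, w s (b j)⟫_ℂ := by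
  classical
  have hw' := isPosOn_univ_iff.2 hw
  refine ⟨fun s i j => ?_, fun c => ?_⟩
  · rw [inner_conj_symm, ← hw'.herm s⁻¹ trivial, inv_inv]
  · have h := hw'.nonneg (c.support.image Prod.fst) (fun _ _ _ _ => trivial)
      fun s => ∑ p ∈ c.support with p.1 = s, c p • b p.2
    have hf : ∀ f : Γ × ι → ℂ, ∑ s ∈ c.support.image Prod.fst, ∑ p ∈ c.support with p.1 = s, f p =
        ∑ p ∈ c.support, f p := fun f =>
      Finset.sum_fiberwise_of_maps_to (fun p hp => Finset.mem_image_of_mem _ hp) f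
    convert h using 2
    unfold kernelForm Finsupp.sum
    rw [← hf]
    refine Finset.sum_congr rfl fun s _ => ?_
    simp only [sum_inner]
    refine Eq.trans ?_ Finset.sum_comm
    refine Finset.sum_congr rfl fun p hp => ?_
    rw [← hf]
    refine Finset.sum_congr rfl fun t _ => ?_
    rw [map_sum, inner_sum]
    refine Finset.sum_congr rfl fun q hq => ?_
    rw [(Finset.mem_filter.1 hp).2, (Finset.mem_filter.1 hq).2, map_smul, inner_smul_left,
      inner_smul_right, mul_assoc]

end PosSemidef

end

/-! ### Integration to C⋆(Γ) and completely bounded norms -/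

theorem opNorm_le_of_inner_le {E F : Type*} [NormedAddCommGroup E] [InnerProductSpace ℂ E]
    [NormedAddCommGroup F] [InnerProductSpace ℂ F] (T : E →L[ℂ] F) {C : ℝ} (hC : 0 ≤ C)
    (h : ∀ x y, ‖⟪y, T x⟫_ℂ‖ ≤ C * ‖y‖ * ‖x‖) : ‖T‖ ≤ C := by
  refine T.opNorm_le_bound hC fun x => ?_
  have h1 := h x (T x)
  rw [inner_self_eq_norm_sq_to_K] at h1
  rcases (norm_nonneg (T x)).eq_or_lt with h0 | h0
  · rw [← h0]; positivity
  · refine le_of_mul_le_mul_left ?_ h0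
    have h2 : ‖((‖T x‖ : ℂ)) ^ 2‖ = ‖T x‖ * ‖T x‖ := by
      rw [norm_pow, Complex.norm_real, norm_norm, sq]
    calc ‖T x‖ * ‖T x‖ = _ := h2.symm
      _ ≤ _ := h1
      _ = _ := by ring

section CompletelyBounded

variable {Γ : Type u} [Group Γ] {H : Type v} [NormedAddCommGroup H] [InnerProductSpace ℂ H]

/-- Finitely many coefficients of a positive semi-definite function are coefficients of a
representation of `C⋆(Γ)`. -/
theorem IsPosSemidef.exists_evalRep {w : Γ → (H →L[ℂ] H)} (hw : IsPosSemidef w) {ι : Type}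
    (b : ι → H) : ∃ (ρ : UnitaryRep Γ) (v : ι → ρ.space),
      (∀ s i j, ⟪b i, w s (b j)⟫_ℂ = ⟪v i, evalRep ρ (delta s) (v j)⟫_ℂ) ∧
        ∀ i, ‖v i‖ ^ 2 ≤ ‖w 1‖ * ‖b i‖ ^ 2 := by
  obtain ⟨ρ, v, h⟩ := (hw.isPosKernel b).exists_evalRep
  refine ⟨ρ, v, h, fun i => ?_⟩
  have h1 := h 1 i i
  rw [delta_one, map_one, one_apply_eq_self, inner_self_eq_norm_sq_to_K] at h1
  have h2 : ‖((‖v i‖ : ℂ)) ^ 2‖ = ‖v i‖ ^ 2 := by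
    rw [norm_pow, Complex.norm_real, norm_norm]
  rw [← h2]
  calc ‖((‖v i‖ : ℂ)) ^ 2‖ = _ := congrArg norm h1.symm
    _ ≤ ‖b i‖ * ‖w 1 (b i)‖ := norm_inner_le_norm _ _
    _ ≤ ‖b i‖ * (‖w 1‖ * ‖b i‖) := by gcongr; exact (w 1).le_opNorm _
    _ = _ := by ring

theorem mul_le_of_sq_le {a b c x y : ℝ} (hx : 0 ≤ x) (hy : 0 ≤ y) (hc : 0 ≤ c)
    (ha : a ^ 2 ≤ c * x ^ 2) (hb : b ^ 2 ≤ c * y ^ 2) : a * b ≤ c * x * y := by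
  refine abs_le_of_sq_le_sq' ?_ (by positivity) |>.2
  calc (a * b) ^ 2 = a ^ 2 * b ^ 2 := by ring
    _ ≤ (c * x ^ 2) * (c * y ^ 2) := by gcongr
    _ = _ := by ring

/-- A positive semi-definite function on `Γ` integrates to a bounded map on `C⋆(Γ)`. -/
theorem IsPosSemidef.exists_clm [CompleteSpace H] {w : Γ → (H →L[ℂ] H)} (hw : IsPosSemidef w) :
    ∃ φ : GroupCStar Γ →L[ℂ] (H →L[ℂ] H), ∀ s, φ (delta s) = w s := by
  have hbound : ∀ c : Γ →₀ ℂ, ‖Finsupp.linearCombination ℂ w c‖ ≤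
      ‖w 1‖ * ‖groupAlgebraIncl Γ c‖ := fun c => by
    refine opNorm_le_of_inner_le _ (by positivity) fun x y => ?_
    -- Dilating only the pair (y, x) suffices for one coefficient; the representation may vary with
    -- the pair, since only the resulting uniform bound is used.
    obtain ⟨ρ, v, h1, h2⟩ := hw.exists_evalRep ![y, x]
    have h3 : ⟪y, Finsupp.linearCombination ℂ w c x⟫_ℂ =
        ⟪v 0, evalRep ρ (groupAlgebraIncl Γ c) (v 1)⟫_ℂ := by
      simp only [groupAlgebraIncl, Finsupp.linearCombination_apply, Finsupp.sum, map_sum, map_smul,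
        sum_apply, smul_apply, inner_sum, inner_smul_right, ← h1]
      simp
    have h4 : ‖v 0‖ * ‖v 1‖ ≤ ‖w 1‖ * ‖y‖ * ‖x‖ :=
      mul_le_of_sq_le (norm_nonneg _) (norm_nonneg _) (norm_nonneg _) (h2 0) (h2 1)
    rw [h3]
    calc _ ≤ ‖v 0‖ * ‖evalRep ρ (groupAlgebraIncl Γ c) (v 1)‖ := norm_inner_le_norm _ _
      _ ≤ ‖v 0‖ * (‖groupAlgebraIncl Γ c‖ * ‖v 1‖) := by
        gcongr
        refine ((evalRep ρ _).le_opNorm _).trans ?_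
        gcongr
        exact NonUnitalStarAlgHom.norm_apply_le (evalRep ρ) _
      _ = ‖groupAlgebraIncl Γ c‖ * (‖v 0‖ * ‖v 1‖) := by ring
      _ ≤ ‖groupAlgebraIncl Γ c‖ * (‖w 1‖ * ‖y‖ * ‖x‖) := by gcongr
      _ = _ := by ring
  refine ⟨(Finsupp.linearCombination ℂ w).extendOfNorm (groupAlgebraIncl Γ), fun s => ?_⟩
  have := LinearMap.extendOfNorm_eq denseRange_groupAlgebraIncl ⟨_, hbound⟩ (Finsupp.single s 1)
  rwa [groupAlgebraIncl_single, one_smul, Finsupp.linearCombination_single, one_smul] at this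

/-- Both sides are continuous and linear in a, so agreement on the generators spreads to all of
C⋆(Γ). -/
theorem IsPosSemidef.exists_evalRep_clm {w : Γ → (H →L[ℂ] H)} (hw : IsPosSemidef w)
    {φ : GroupCStar Γ →L[ℂ] (H →L[ℂ] H)} (hφ : ∀ s, φ (delta s) = w s) {ι : Type}
    (b : ι → H) : ∃ (ρ : UnitaryRep Γ) (v : ι → ρ.space),
      (∀ a i j, ⟪b i, φ a (b j)⟫_ℂ = ⟪v i, evalRep ρ a (v j)⟫_ℂ) ∧
        ∀ i, ‖v i‖ ^ 2 ≤ ‖w 1‖ * ‖b i‖ ^ 2 := by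
  obtain ⟨ρ, v, h1, h2⟩ := hw.exists_evalRep b
  refine ⟨ρ, v, fun a i j => ?_, h2⟩
  let E : GroupCStar Γ →L[ℂ] (ρ.space →L[ℂ] ρ.space) :=
    ⟨(evalRep ρ).toLinearMap, continuous_evalRep ρ⟩
  have h := groupCStar_clm_ext (φ := innerSL ℂ (b i) ∘L (ContinuousLinearMap.apply ℂ H (b j)) ∘L φ)
    (ψ := innerSL ℂ (v i) ∘L (ContinuousLinearMap.apply ℂ ρ.space (v j)) ∘L E) fun s => by
      change ⟪b i, φ (delta s) (b j)⟫_ℂ = ⟪v i, evalRep ρ (delta s) (v j)⟫_ℂ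
      rw [hφ, h1]
  exact DFunLike.congr_fun h a

variable {N : Type} [Fintype N] [DecidableEq N]

theorem IsPosSemidef.re_sum_nonneg {w : Γ → (H →L[ℂ] H)} (hw : IsPosSemidef w)
    {φ : GroupCStar Γ →L[ℂ] (H →L[ℂ] H)} (hφ : ∀ s, φ (delta s) = w s) {x : MatCStar N Γ}
    (hx : 0 ≤ x) (b : N → H) : 0 ≤ (∑ i, ∑ j, ⟪b i, φ (x i j) (b j)⟫_ℂ).re := by
  obtain ⟨ρ, v, h, -⟩ := hw.exists_evalRep_clm hφ b
  simp only [h]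
  have h1 : 0 ≤ blockHom N (evalRep ρ) x := map_nonneg _ hx
  have h2 := ((ContinuousLinearMap.nonneg_iff_isPositive _).1 h1).re_inner_nonneg_right
    (WithLp.toLp 2 v)
  rwa [inner_blockHom] at h2

/-- The bound on x is required representation by representation so that the lemma serves both norms:
for C⋆(Γ) it follows from the norm of x, for UOS(Δ) from a positive 2 × 2 block matrix. -/
theorem IsPosSemidef.norm_blockOperator_le {w : Γ → (H →L[ℂ] H)} (hw : IsPosSemidef w)
    {φ : GroupCStar Γ →L[ℂ] (H →L[ℂ] H)} (hφ : ∀ s, φ (delta s) = w s) {x : MatCStar N Γ}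
    {C : ℝ} (hC : 0 ≤ C) (hx : ∀ ρ : UnitaryRep Γ, ‖blockHom N (evalRep ρ) x‖ ≤ C) :
    ‖blockOperator (Matrix.of fun i j => φ (x i j))‖ ≤ ‖w 1‖ * C := by
  refine opNorm_le_of_inner_le _ (by positivity) fun ξ η => ?_
  -- The entries of both test vectors are dilated simultaneously, so that they lie in one
  -- representation space.
  obtain ⟨ρ, v, h1, h2⟩ := hw.exists_evalRep_clm hφ (Sum.elim η ξ)
  let η' : PiLp 2 (fun _ : N => ρ.space) := WithLp.toLp 2 fun i => v (Sum.inl i)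
  let ξ' : PiLp 2 (fun _ : N => ρ.space) := WithLp.toLp 2 fun i => v (Sum.inr i)
  have h3 : ⟪η, blockOperator (Matrix.of fun i j => φ (x i j)) ξ⟫_ℂ =
      ⟪η', blockHom N (evalRep ρ) x ξ'⟫_ℂ := by
    rw [inner_blockOperator, inner_blockHom]
    exact Finset.sum_congr rfl fun i _ => Finset.sum_congr rfl fun j _ =>
      h1 (x i j) (Sum.inl i) (Sum.inr j)
  have h4 : ‖η'‖ ^ 2 ≤ ‖w 1‖ * ‖η‖ ^ 2 := by
    rw [PiLp.norm_sq_eq_of_L2, PiLp.norm_sq_eq_of_L2, Finset.mul_sum]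
    exact Finset.sum_le_sum fun i _ => h2 (Sum.inl i)
  have h5 : ‖ξ'‖ ^ 2 ≤ ‖w 1‖ * ‖ξ‖ ^ 2 := by
    rw [PiLp.norm_sq_eq_of_L2, PiLp.norm_sq_eq_of_L2, Finset.mul_sum]
    exact Finset.sum_le_sum fun i _ => h2 (Sum.inr i)
  have h6 := mul_le_of_sq_le (norm_nonneg _) (norm_nonneg _) (norm_nonneg _) h4 h5
  rw [h3]
  calc _ ≤ ‖η'‖ * ‖blockHom N (evalRep ρ) x ξ'‖ := norm_inner_le_norm _ _
    _ ≤ ‖η'‖ * (C * ‖ξ'‖) := by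
      gcongr
      exact ContinuousLinearMap.le_of_opNorm_le _ (hx ρ) _
    _ = C * (‖η'‖ * ‖ξ'‖) := by ring
    _ ≤ C * (‖w 1‖ * ‖η‖ * ‖ξ‖) := by gcongr
    _ = _ := by ring

theorem norm_blockOperator_one {K : Type v} [NormedAddCommGroup K] [InnerProductSpace ℂ K]
    (T : K →L[ℂ] K) : ‖T‖ ≤ ‖blockOperator (Matrix.of fun _ _ : Fin 1 => T)‖ := by
  refine T.opNorm_le_bound (ContinuousLinearMap.opNorm_nonneg _) fun x => ?_
  have h := (blockOperator (Matrix.of fun _ _ : Fin 1 => T)).le_opNorm (WithLp.toLp 2 fun _ => x)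
  simpa [PiLp.norm_eq_of_L2] using h

/-- The upper bound comes from dilation; the lower bound is attained at the unit of the 1 × 1
matrices. -/
theorem IsPosSemidef.fsNorm_eq [CompleteSpace H] {w : Γ → (H →L[ℂ] H)} (hw : IsPosSemidef w) :
    fsNorm w = ‖w 1‖ₑ := by
  refine le_antisymm ?_ ?_
  · obtain ⟨φ, hφ⟩ := hw.exists_clm
    refine (iInf₂_le φ hφ).trans (iSup_le fun n => iSup₂_le fun x hx => ?_)
    rw [← ofReal_norm, ← ofReal_norm]
    refine ENNReal.ofReal_le_ofReal ?_
    have := hw.norm_blockOperator_le hφ zero_le_one fun ρ => (norm_blockHom_le (evalRep ρ) x).trans hx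
    rwa [mul_one] at this
  · refine le_iInf₂ fun φ hφ => ?_
    have h1 : ‖(1 : MatCStar (Fin 1) Γ)‖ ≤ 1 :=
    (CStarAlgebra.norm_le_one_iff_of_nonneg _ zero_le_one).2 le_rfl
    refine le_trans ?_ (le_iSup_of_le 1 (le_iSup₂_of_le (1 : MatCStar (Fin 1) Γ) h1 le_rfl))
    have h2 : (Matrix.of fun i j : Fin 1 => φ ((1 : MatCStar (Fin 1) Γ) i j)) =
        Matrix.of fun _ _ => w 1 := by
      refine Matrix.ext fun i j => ?_
      rw [Matrix.of_apply, Matrix.of_apply, Subsingleton.elim i j, CStarMatrix.one_apply_eq,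
        ← delta_one, hφ]
    rw [h2, ← ofReal_norm, ← ofReal_norm]
    exact ENNReal.ofReal_le_ofReal (norm_blockOperator_one _)

/-- A contraction criterion by positivity of a `2 × 2` block matrix. -/
theorem norm_blockHom_le_of_fromBlocks [CompleteSpace H] {A : Type w} [CStarAlgebra A]
    [PartialOrder A] [StarOrderedRing A] (π : A →⋆ₐ[ℂ] (H →L[ℂ] H)) (x : Matrix N N A) {r : ℝ}
    (hr : 0 ≤ r) (hx : 0 ≤ CStarMatrix.ofMatrix (Matrix.fromBlocks ((r : ℂ) • (1 : Matrix N N A)) x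
      x.conjTranspose ((r : ℂ) • (1 : Matrix N N A)))) :
    ‖blockHom N π (CStarMatrix.ofMatrix x)‖ ≤ r := by
  set P := CStarMatrix.ofMatrix (Matrix.fromBlocks ((r : ℂ) • (1 : Matrix N N A)) x
      x.conjTranspose ((r : ℂ) • (1 : Matrix N N A))) with hP
  set T := blockHom N π (CStarMatrix.ofMatrix x) with hT
  have h1 : 0 ≤ blockHom (N ⊕ N) π P := map_nonneg _ hx
  have h2 : ∀ η ξ : PiLp 2 (fun _ : N => H),
      0 ≤ r * ‖η‖ ^ 2 + r * ‖ξ‖ ^ 2 + 2 * (⟪η, T ξ⟫_ℂ).re := fun η ξ => by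
    have h3 := ((ContinuousLinearMap.nonneg_iff_isPositive _).1 h1).re_inner_nonneg_right
      (WithLp.toLp 2 (Sum.elim η ξ))
    have hsmul : ∀ i j : N, π (((r : ℂ) • (1 : Matrix N N A)) i j) =
        if i = j then (r : ℂ) • (1 : H →L[ℂ] H) else 0 := fun i j => by
      rw [Matrix.smul_apply, Matrix.one_apply]
      split_ifs
      · rw [map_smul, map_one]
      · rw [smul_zero, map_zero]
    have h4 : ∀ ζ : PiLp 2 (fun _ : N => H),
        ∑ i, ∑ j, ⟪ζ i, π (((r : ℂ) • (1 : Matrix N N A)) i j) (ζ j)⟫_ℂ =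
          ((r * ‖ζ‖ ^ 2 : ℝ) : ℂ) := fun ζ => by
      rw [PiLp.norm_sq_eq_of_L2, Finset.mul_sum, Complex.ofReal_sum]
      refine Finset.sum_congr rfl fun i _ => ?_
      rw [Finset.sum_eq_single i (fun j _ hj => by rw [hsmul, if_neg hj.symm]; simp) (by simp),
        hsmul, if_pos rfl, smul_apply, one_apply_eq_self, inner_smul_right,
        inner_self_eq_norm_sq_to_K]
      push_cast
      rfl
    have h5 : ∑ i, ∑ j, ⟪η i, π (x i j) (ξ j)⟫_ℂ = ⟪η, T ξ⟫_ℂ := (inner_blockHom π _ η ξ).symm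
    have h6 : ∑ i, ∑ j, ⟪ξ i, π (x.conjTranspose i j) (η j)⟫_ℂ = conj ⟪η, T ξ⟫_ℂ := by
      rw [← h5, Finset.sum_comm]
      simp only [map_sum, Matrix.conjTranspose_apply, map_star, ContinuousLinearMap.star_eq_adjoint,
        ContinuousLinearMap.adjoint_inner_right, inner_conj_symm]
    have h7 : ⟪WithLp.toLp 2 (Sum.elim η ξ), blockHom (N ⊕ N) π P (WithLp.toLp 2 (Sum.elim η ξ))⟫_ℂ
        = ((r * ‖η‖ ^ 2 : ℝ) : ℂ) + ⟪η, T ξ⟫_ℂ +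
          (conj ⟪η, T ξ⟫_ℂ + ((r * ‖ξ‖ ^ 2 : ℝ) : ℂ)) := by
      rw [inner_blockHom, Fintype.sum_sum_type]
      simp only [Fintype.sum_sum_type, Finset.sum_add_distrib]
      rw [← h6, ← h5, ← h4, ← h4]
      rfl
    rw [h7] at h3
    simp only [map_add, RCLike.re_eq_complex_re, Complex.ofReal_re, Complex.conj_re] at h3
    linarith
  refine ContinuousLinearMap.opNorm_le_bound _ hr fun ξ => ?_
  have h3 : ∀ t : ℝ, 0 ≤ r * t ^ 2 * ‖T ξ‖ ^ 2 + r * ‖ξ‖ ^ 2 - 2 * t * ‖T ξ‖ ^ 2 := fun t => by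
    -- With η = -tTξ the cross term becomes -2t‖Tξ‖². Then t = 1/r gives the bound when r > 0, and t
    -- = 1 forces Tξ = 0 when r = 0.
    have h4 := h2 ((-t : ℂ) • T ξ) ξ
    rw [inner_smul_left, inner_self_eq_norm_sq_to_K, norm_smul, norm_neg, Complex.norm_real,
      mul_pow, Real.norm_eq_abs, sq_abs] at h4
    have h5 : (conj (-t : ℂ) * ((‖T ξ‖ : ℝ) : ℂ) ^ 2).re = -t * ‖T ξ‖ ^ 2 := by
      rw [map_neg, Complex.conj_ofReal, ← Complex.ofReal_pow, ← Complex.ofReal_neg,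
        ← Complex.ofReal_mul, Complex.ofReal_re]
    erw [h5] at h4
    linarith
  rcases hr.eq_or_lt with h0 | h0
  · have h4 := h3 1
    rw [← h0] at h4 ⊢
    have h5 : ‖T ξ‖ ^ 2 ≤ 0 := by linarith
    have h6 : ‖T ξ‖ = 0 := by nlinarith [sq_nonneg ‖T ξ‖, norm_nonneg (T ξ)]
    rw [h6, zero_mul]
  · have h4 := h3 r⁻¹
    have h5 : r * r⁻¹ ^ 2 * ‖T ξ‖ ^ 2 + r * ‖ξ‖ ^ 2 - 2 * r⁻¹ * ‖T ξ‖ ^ 2 =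
        r⁻¹ * ((r * ‖ξ‖) ^ 2 - ‖T ξ‖ ^ 2) := by
      field_simp
      ring
    rw [h5] at h4
    have h6 := nonneg_of_mul_nonneg_right h4 (inv_pos.2 h0)
    exact abs_le_of_sq_le_sq' (by linarith) (by positivity) |>.2

end CompletelyBounded

/-! ## Finitely supported matrices and sums of squares -/

section SumOfSquares

variable {Γ : Type u} [Group Γ] {m : Type}

theorem tensorDelta_apply (A : Matrix m m ℂ) (s : Γ) (i j : m) :
    tensorDelta A s i j = A i j • delta s := rfl

theorem tensorDelta_zero (s : Γ) : tensorDelta (0 : Matrix m m ℂ) s = 0 := by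
  ext i j
  simp [tensorDelta_apply]

theorem tensorDelta_add (A B : Matrix m m ℂ) (s : Γ) :
    tensorDelta (A + B) s = tensorDelta A s + tensorDelta B s := by
  ext i j
  simp [tensorDelta_apply, add_smul]

theorem tensorDelta_smul (c : ℂ) (A : Matrix m m ℂ) (s : Γ) :
    tensorDelta (c • A) s = c • tensorDelta A s := by
  ext i j
  simp [tensorDelta_apply, smul_smul]

theorem star_tensorDelta (A : Matrix m m ℂ) (s : Γ) :
    star (tensorDelta A s) = tensorDelta A.conjTranspose s⁻¹ := by
  ext i j
  simp [tensorDelta_apply, CStarMatrix.star_apply, star_delta]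

theorem tensorDelta_mul [Fintype m] (A B : Matrix m m ℂ) (s t : Γ) :
    tensorDelta A s * tensorDelta B t = tensorDelta (A * B) (s * t) := by
  ext i j
  simp [tensorDelta_apply, CStarMatrix.mul_apply, Matrix.mul_apply, Finset.sum_smul, smul_smul,
    delta_mul, mul_comm]

theorem tensorDelta_one [DecidableEq m] : tensorDelta (1 : Matrix m m ℂ) (1 : Γ) = 1 := by
  ext i j
  rw [tensorDelta_apply, Matrix.one_apply, CStarMatrix.one_apply, delta_one]
  split_ifs <;> simp

theorem supportedOn_tensorDelta (A : Matrix m m ℂ) (s : Γ) : SupportedOn {s} (tensorDelta A s) :=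
  ⟨fun _ => A, by simp⟩

theorem SupportedOn.mono {F G : Finset Γ} (h : F ⊆ G) {x : MatCStar m Γ} (hx : SupportedOn F x) :
    SupportedOn G x := by
  classical
  obtain ⟨A, rfl⟩ := hx
  refine ⟨fun s => if s ∈ F then A s else 0, ?_⟩
  rw [← Finset.sum_subset h fun s _ hs => by simp [hs, tensorDelta_zero]]
  exact Finset.sum_congr rfl fun s hs => by simp [hs]

theorem SupportedOn.add {F : Finset Γ} {x y : MatCStar m Γ} (hx : SupportedOn F x)
    (hy : SupportedOn F y) : SupportedOn F (x + y) := by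
  obtain ⟨A, rfl⟩ := hx
  obtain ⟨B, rfl⟩ := hy
  exact ⟨A + B, by simp [tensorDelta_add, Finset.sum_add_distrib]⟩

theorem SupportedOn.smul {F : Finset Γ} {x : MatCStar m Γ} (hx : SupportedOn F x) (c : ℂ) :
    SupportedOn F (c • x) := by
  obtain ⟨A, rfl⟩ := hx
  exact ⟨c • A, by simp [tensorDelta_smul, Finset.smul_sum]⟩

/-- The matrices over `C⋆(Γ)` with finite support in `Δ`. -/
def supportedSubmodule (m : Type) (Δ : Set Γ) : Submodule ℂ (MatCStar m Γ) where
  carrier := {x | ∃ F : Finset Γ, (F : Set Γ) ⊆ Δ ∧ SupportedOn F x}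
  add_mem' := by
    classical
    rintro x y ⟨F, hF, hx⟩ ⟨G, hG, hy⟩
    exact ⟨F ∪ G, by simp [hF, hG], (hx.mono Finset.subset_union_left).add
      (hy.mono Finset.subset_union_right)⟩
  zero_mem' := ⟨∅, by simp, 0, by simp⟩
  smul_mem' := fun c x ⟨F, hF, hx⟩ => ⟨F, hF, hx.smul c⟩

theorem tensorDelta_mem_supportedSubmodule {Δ : Set Γ} (A : Matrix m m ℂ) {s : Γ} (hs : s ∈ Δ) :
    tensorDelta A s ∈ supportedSubmodule m Δ :=
  ⟨{s}, by simpa using hs, supportedOn_tensorDelta A s⟩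

theorem sum_mat_apply {κ : Type*} (S : Finset κ) (y : κ → MatCStar m Γ) (i j : m) :
    (∑ q ∈ S, y q) i j = ∑ q ∈ S, y q i j :=
  Matrix.sum_apply i j S y

theorem sum_comm_cycle {α β κ V : Type*} [AddCommMonoid V] (R : Finset α) (S : Finset β)
    (T : Finset κ) (f : α → β → κ → V) :
    ∑ i ∈ R, ∑ j ∈ S, ∑ k ∈ T, f i j k = ∑ k ∈ T, ∑ i ∈ R, ∑ j ∈ S, f i j k := by
  rw [Finset.sum_comm (s := T)]
  exact Finset.sum_congr rfl fun i _ => Finset.sum_comm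

variable [Fintype m] {Δ : Set Γ}

theorem isSumOfSquares_zero : IsSumOfSquares Δ (0 : MatCStar m Γ) :=
  ⟨0, Fin.elim0, Fin.elim0, fun i => i.elim0, fun i => i.elim0, by simp⟩

theorem isSumOfSquares_mul_star {F : Finset Γ} (hF : IsAdmissible Δ F) {y : MatCStar m Γ}
    (hy : SupportedOn F y) : IsSumOfSquares Δ (y * star y) :=
  ⟨1, fun _ => F, fun _ => y, fun _ => hF, fun _ => hy, by simp⟩

theorem IsSumOfSquares.add {x y : MatCStar m Γ} (hx : IsSumOfSquares Δ x)
    (hy : IsSumOfSquares Δ y) : IsSumOfSquares Δ (x + y) := by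
  obtain ⟨r, F, a, hF, ha, rfl⟩ := hx
  obtain ⟨q, G, b, hG, hb, rfl⟩ := hy
  refine ⟨r + q, Fin.append F G, Fin.append a b, fun i => ?_, fun i => ?_, ?_⟩
  · induction i using Fin.addCases <;> simp [hF, hG]
  · induction i using Fin.addCases <;> simp [ha, hb]
  · simp [Fin.sum_univ_add]

theorem IsSumOfSquares.smul {x : MatCStar m Γ} (hx : IsSumOfSquares Δ x) {t : ℝ} (ht : 0 ≤ t) :
    IsSumOfSquares Δ ((t : ℂ) • x) := by
  obtain ⟨r, F, a, hF, ha, rfl⟩ := hx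
  refine ⟨r, F, fun i => (√t : ℂ) • a i, hF, fun i => (ha i).smul _, ?_⟩
  rw [Finset.smul_sum]
  refine Finset.sum_congr rfl fun i _ => ?_
  rw [star_smul, smul_mul_assoc, mul_smul_comm, smul_smul, Complex.star_def, Complex.conj_ofReal,
    ← Complex.ofReal_mul, Real.mul_self_sqrt ht]

theorem isAdmissible_singleton (hΔ : IsPositivityDomain Δ) (s : Γ) : IsAdmissible Δ {s} := by
  intro a ha b hb
  rw [Finset.mem_singleton.1 ha, Finset.mem_singleton.1 hb, mul_inv_cancel]
  exact hΔ.one_mem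

theorem isSumOfSquares_tensorDelta (hΔ : IsPositivityDomain Δ) (B : Matrix m m ℂ) :
    IsSumOfSquares Δ (tensorDelta (B * B.conjTranspose) (1 : Γ)) := by
  have := isSumOfSquares_mul_star (isAdmissible_singleton hΔ (1 : Γ)) (supportedOn_tensorDelta B 1)
  rwa [star_tensorDelta, tensorDelta_mul, inv_one, mul_one] at this

theorem IsSumOfSquares.nonneg {x : MatCStar m Γ} (hx : IsSumOfSquares Δ x) : 0 ≤ x := by
  obtain ⟨r, F, a, -, -, rfl⟩ := hx
  exact Finset.sum_nonneg fun i _ => mul_star_self_nonneg _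

/-- Positive semi-definite functions are positive on sums of squares. -/
theorem IsSumOfSquares.re_sum_nonneg {H : Type v} [NormedAddCommGroup H] [InnerProductSpace ℂ H]
    {g : Γ → (H →L[ℂ] H)} (hg : IsPosOn Δ g) {ψ : GroupCStar Γ →ₗ[ℂ] (H →L[ℂ] H)}
    (hψ : ∀ s, ψ (delta s) = g s) {x : MatCStar m Γ} (hx : IsSumOfSquares Δ x) (b : m → H) :
    0 ≤ (∑ i, ∑ j, ⟪b i, ψ (x i j) (b j)⟫_ℂ).re := by
  obtain ⟨r, F, y, hF, hy, rfl⟩ := hx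
  have key : ∀ q, 0 ≤ (∑ i, ∑ j, ⟪b i, ψ ((y q * star (y q)) i j) (b j)⟫_ℂ).re := fun q => by
    obtain ⟨A, hA⟩ := hy q
    -- Each column k of y = ∑ A_s ⊗ δ_s contributes one quadratic form of g, at the vectors ξ(s) = ∑
    -- conj(A_s(i, k)) b(i). Admissibility of the support makes it nonnegative.
    have h : ∑ i, ∑ j, ⟪b i, ψ ((y q * star (y q)) i j) (b j)⟫_ℂ =
        ∑ k, ∑ s ∈ F q, ∑ t ∈ F q,
          ⟪∑ i, conj (A s i k) • b i, g (s * t⁻¹) (∑ j, conj (A t j k) • b j)⟫_ℂ := by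
      have h1 : ∀ i j, (y q * star (y q)) i j =
          ∑ k, ∑ s ∈ F q, ∑ t ∈ F q, (A s i k * conj (A t j k)) • delta (s * t⁻¹) := fun i j => by
        have h2 : ∀ i k, y q i k = ∑ s ∈ F q, A s i k • delta s := fun i k => by
          rw [hA, sum_mat_apply]
          rfl
        rw [CStarMatrix.mul_apply]
        refine Finset.sum_congr rfl fun k _ => ?_
        rw [CStarMatrix.star_apply, h2, h2, star_sum, Finset.sum_mul_sum]
        refine Finset.sum_congr rfl fun s _ => Finset.sum_congr rfl fun t _ => ?_
        rw [star_smul, star_delta, smul_mul_smul_comm, delta_mul, Complex.star_def]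
      have h2 : ∀ k s t, ⟪∑ i, conj (A s i k) • b i, g (s * t⁻¹) (∑ j, conj (A t j k) • b j)⟫_ℂ =
          ∑ i, ∑ j, A s i k * conj (A t j k) * ⟪b i, g (s * t⁻¹) (b j)⟫_ℂ := fun k s t => by
        rw [sum_inner]
        refine Finset.sum_congr rfl fun i _ => ?_
        rw [map_sum, inner_sum]
        refine Finset.sum_congr rfl fun j _ => ?_
        rw [map_smul, inner_smul_left, inner_smul_right, Complex.conj_conj, mul_assoc]
      simp only [h2]
      simp only [h1, map_sum, map_smul, hψ, sum_apply, smul_apply, inner_sum, inner_smul_right]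
      rw [sum_comm_cycle]
      refine Finset.sum_congr rfl fun k _ => ?_
      rw [sum_comm_cycle]
      refine Finset.sum_congr rfl fun s _ => ?_
      rw [sum_comm_cycle]
    rw [h, Complex.re_sum]
    exact Finset.sum_nonneg fun k _ => hg.nonneg (F q) (hF q) _
  have h : ∑ i, ∑ j, ⟪b i, ψ ((∑ q, y q * star (y q)) i j) (b j)⟫_ℂ =
      ∑ q, ∑ i, ∑ j, ⟪b i, ψ ((y q * star (y q)) i j) (b j)⟫_ℂ := by
    simp only [sum_mat_apply, map_sum, sum_apply, inner_sum]
    exact sum_comm_cycle _ _ _ _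
  rw [h, Complex.re_sum]
  exact Finset.sum_nonneg fun q _ => key q

variable [DecidableEq m]

theorem isSumOfSquares_one (hΔ : IsPositivityDomain Δ) : IsSumOfSquares Δ (1 : MatCStar m Γ) := by
  have := isSumOfSquares_tensorDelta hΔ (1 : Matrix m m ℂ)
  rwa [Matrix.conjTranspose_one, mul_one, tensorDelta_one] at this

/-- Let ε tend to 0: sums of squares are positive and the positive cone of a C⋆-algebra is closed.
-/
theorem uosCone_nonneg {x : MatCStar m Γ} (hx : x ∈ uosCone m Δ) : 0 ≤ x := by
  have h : Filter.Tendsto (fun ε : ℝ => x + (ε : ℂ) • (1 : MatCStar m Γ)) (nhdsWithin 0 (Set.Ioi 0))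
      (nhds (x + ((0 : ℝ) : ℂ) • (1 : MatCStar m Γ))) := by
    refine Filter.Tendsto.mono_left ?_ nhdsWithin_le_nhds
    refine Continuous.tendsto ?_ 0
    fun_prop
  rw [Complex.ofReal_zero, zero_smul, add_zero] at h
  exact CStarAlgebra.isClosed_nonneg.mem_of_tendsto h
    (Filter.eventually_of_mem self_mem_nhdsWithin fun ε hε => (hx ε hε).nonneg)

/-- The element ‖aa⋆‖1 - aa⋆ is positive, hence of the form bb⋆. -/
theorem exists_smul_one_eq_mul_star {M : Type*} [CStarAlgebra M] (a : M) :
    ∃ r : ℝ, 0 ≤ r ∧ ∃ b : M, (r : ℂ) • (1 : M) = a * star a + b * star b := by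
  let := CStarAlgebra.spectralOrder M
  have := CStarAlgebra.spectralOrderedRing M
  have h1 : a * star a ≤ algebraMap ℝ _ ‖a * star a‖ :=
    IsSelfAdjoint.le_algebraMap_norm_self (IsSelfAdjoint.mul_star_self a)
  obtain ⟨b, hb⟩ := CStarAlgebra.nonneg_iff_eq_mul_star_self.1 (sub_nonneg.2 h1)
  refine ⟨‖a * star a‖, norm_nonneg _, b, ?_⟩
  have h2 := (sub_eq_iff_eq_add.1 hb).trans (add_comm _ _)
  rwa [Algebra.algebraMap_eq_smul_one, ← Complex.coe_smul] at h2

open scoped ComplexOrder in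
theorem exists_smul_one_eq_mul_conjTranspose (A : Matrix m m ℂ) :
    ∃ r : ℝ, 0 ≤ r ∧ ∃ B : Matrix m m ℂ,
      (r : ℂ) • (1 : Matrix m m ℂ) = A * A.conjTranspose + B * B.conjTranspose :=
  exists_smul_one_eq_mul_star (M := CStarMatrix m m ℂ) A

/-- The unit is an order unit for the sums of squares. -/
theorem exists_isSumOfSquares_add (hΔ : IsPositivityDomain Δ) {x : MatCStar m Γ}
    (hx : x ∈ supportedSubmodule m Δ) :
    ∃ r : ℝ, 0 ≤ r ∧ IsSumOfSquares Δ ((r : ℂ) • (1 : MatCStar m Γ) + (x + star x)) := by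
  classical
  obtain ⟨F, hF, A, rfl⟩ := hx
  induction F using Finset.induction_on with
  | empty => exact ⟨0, le_rfl, by simpa using isSumOfSquares_zero⟩
  | insert s F hs ih =>
    obtain ⟨r, hr, h⟩ := ih fun t ht => hF (Finset.mem_insert_of_mem ht)
    obtain ⟨q, hq, B, hB⟩ := exists_smul_one_eq_mul_conjTranspose (A s)
    have hsΔ : s ∈ Δ := hF (Finset.mem_insert_self s F)
    -- Expanding (1 + A ⊗ δ_s)(1 + A ⊗ δ_s)⋆ yields A ⊗ δ_s plus its adjoint, together with 1 + AA⋆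
    -- ⊗ δ_1. Adding BB⋆ completes AA⋆ to the scalar q, so s costs 1 + q.
    have h1 := isSumOfSquares_mul_star (isAdmissible_pair hΔ hsΔ)
      (((supportedOn_tensorDelta (1 : Matrix m m ℂ) (1 : Γ)).mono (by simp)).add
        ((supportedOn_tensorDelta (A s) s).mono (by simp)))
    have h2 := isSumOfSquares_tensorDelta hΔ B
    refine ⟨r + (1 + q), by positivity, ?_⟩
    convert (h1.add h2).add h using 1
    have h3 : (q : ℂ) • (1 : MatCStar m Γ) = tensorDelta (A s * (A s).conjTranspose) 1 +
        tensorDelta (B * B.conjTranspose) 1 := by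
      rw [← tensorDelta_add, ← hB, tensorDelta_smul, tensorDelta_one]
    rw [Finset.sum_insert hs, star_add, star_add, star_tensorDelta, star_tensorDelta, add_mul,
      mul_add, mul_add, tensorDelta_mul, tensorDelta_mul, tensorDelta_mul, tensorDelta_mul]
    simp only [Complex.ofReal_add, add_smul, h3, Matrix.conjTranspose_one, mul_one, one_mul,
      inv_one, mul_inv_cancel, Complex.ofReal_one, one_smul, tensorDelta_one]
    abel

end SumOfSquares

/-! ## The completely bounded norm on `UOS(Δ)` -/

section UOSNorm

variable {Γ : Type u} [Group Γ] {Δ : Set Γ}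

/-- The matrices of the form `x ⊗ E₁₂` in `M_{2n}`. -/
theorem fromBlocks_mem_supportedSubmodule {n : ℕ} (x : Matrix (Fin n) (Fin n) (SpanDelta Δ)) :
    (CStarMatrix.ofMatrix (Matrix.fromBlocks 0 (x.map (inclDelta Δ)) 0 0) :
      MatCStar (Fin n ⊕ Fin n) Γ) ∈ supportedSubmodule (Fin n ⊕ Fin n) Δ := by
  classical
  have h : (CStarMatrix.ofMatrix (Matrix.fromBlocks 0 (x.map (inclDelta Δ)) 0 0) :
      MatCStar (Fin n ⊕ Fin n) Γ) = ∑ s ∈ Finset.univ.biUnion fun i =>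
        Finset.univ.biUnion fun j => (x i j).support,
        tensorDelta (Matrix.fromBlocks 0 (x.map fun c => c s) 0 0) (s : Γ) := by
    ext i j
    rw [sum_mat_apply]
    simp only [tensorDelta_apply]
    rcases i with i | i <;> rcases j with j | j
    · simp
    · change inclDelta Δ (x i j) = ∑ s ∈ _, x i j s • delta (s : Γ)
      rw [inclDelta, Finsupp.linearCombination_apply]
      refine Finsupp.sum_of_support_subset _ (fun s hs => ?_) _ (by simp)
      simp only [Finset.mem_biUnion, Finset.mem_univ, true_and]
      exact ⟨i, j, hs⟩
    · simp
    · simp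
  rw [h]
  exact Submodule.sum_mem _ fun s _ => tensorDelta_mem_supportedSubmodule _ s.2

/-- The order unit property applied to x placed in the upper right corner. Nonemptiness rules out
the default value 0 of the infimum of an empty set. -/
theorem uosNorm_set_nonempty (hΔ : IsPositivityDomain Δ) {n : ℕ}
    (x : Matrix (Fin n) (Fin n) (SpanDelta Δ)) :
    {r : ℝ | 0 ≤ r ∧ CStarMatrix.ofMatrix (Matrix.fromBlocks
      ((r : ℂ) • (1 : Matrix (Fin n) (Fin n) (GroupCStar Γ))) (x.map (inclDelta Δ))
      (x.map (inclDelta Δ)).conjTranspose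
      ((r : ℂ) • (1 : Matrix (Fin n) (Fin n) (GroupCStar Γ)))) ∈
        uosCone (Fin n ⊕ Fin n) Δ}.Nonempty := by
  obtain ⟨r, hr, h⟩ := exists_isSumOfSquares_add hΔ (fromBlocks_mem_supportedSubmodule x)
  refine ⟨r, hr, fun ε hε => IsSumOfSquares.add ?_ ((isSumOfSquares_one hΔ).smul hε.le)⟩
  convert h using 1
  generalize (r : ℂ) = c
  ext i j
  rcases i with i | i <;> rcases j with j | j <;>
    simp [CStarMatrix.star_apply, CStarMatrix.one_apply, Matrix.one_apply]

theorem uosNorm_single_le (hΔ : IsPositivityDomain Δ) :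
    uosNorm (Matrix.of fun _ _ : Fin 1 => (Finsupp.single ⟨1, hΔ.one_mem⟩ 1 : SpanDelta Δ)) ≤ 1 := by
  refine csInf_le ⟨0, fun r hr => hr.1⟩ ⟨zero_le_one, fun ε hε =>
    IsSumOfSquares.add ?_ ((isSumOfSquares_one hΔ).smul hε.le)⟩
  -- The 2 × 2 matrix of ones is BB⋆, where B has a first column of ones and zeros elsewhere.
  convert isSumOfSquares_tensorDelta hΔ
    (Matrix.fromBlocks 1 0 1 0 : Matrix (Fin 1 ⊕ Fin 1) (Fin 1 ⊕ Fin 1) ℂ) using 1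
  ext i j
  rcases i with i | i <;> rcases j with j | j <;> rw [Subsingleton.elim i 0, Subsingleton.elim j 0] <;>
    simp [tensorDelta_apply, Matrix.fromBlocks_conjTranspose, Matrix.fromBlocks_multiply, inclDelta,
      delta_one]

/-- The extension w' supplies the upper bound: elements of the cone of UOS(Δ) are positive in
matrices over C⋆(Γ), so the estimate there applies. The lower bound comes from δ_1. -/
theorem IsPosSemidef.fsNormOn_eq (hΔ : IsPositivityDomain Δ) {H : Type v} [NormedAddCommGroup H]
    [InnerProductSpace ℂ H] [CompleteSpace H] {w' : Γ → (H →L[ℂ] H)} (hw : IsPosSemidef w')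
    {w : Δ → (H →L[ℂ] H)} (h : ∀ s : Δ, w' s = w s) : fsNormOn Δ w = ‖w' 1‖ₑ := by
  refine le_antisymm ?_ ?_
  · obtain ⟨φ, hφ⟩ := hw.exists_clm
    refine iSup_le fun n => iSup₂_le fun x hx => ?_
    rw [← ofReal_norm, ← ofReal_norm]
    refine ENNReal.ofReal_le_ofReal (le_of_forall_pos_le_add fun δ hδ => ?_)
    have hx' : x.map (Finsupp.linearCombination ℂ w : SpanDelta Δ →ₗ[ℂ] (H →L[ℂ] H)) =
        Matrix.of fun i j => φ ((CStarMatrix.ofMatrix (x.map (inclDelta Δ)) :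
          MatCStar (Fin n) Γ) i j) := by
      refine Matrix.ext fun i j => ?_
      change Finsupp.linearCombination ℂ w (x i j) = φ (inclDelta Δ (x i j))
      simp [inclDelta, Finsupp.linearCombination_apply, Finsupp.sum, hφ, h]
    -- The infimum is only approximated. The slack δ/(‖w' 1‖ + 1) costs at most δ after
    -- multiplication by ‖w' 1‖, and the added 1 avoids division by zero.
    obtain ⟨r, ⟨hr0, hr⟩, hr1⟩ := exists_lt_of_csInf_lt (uosNorm_set_nonempty hΔ x)
      (lt_of_le_of_lt hx (lt_add_of_pos_right 1 (div_pos hδ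
        (add_pos_of_nonneg_of_pos (norm_nonneg (w' 1)) one_pos))))
    rw [hx']
    refine (hw.norm_blockOperator_le hφ hr0 fun ρ =>
      norm_blockHom_le_of_fromBlocks (evalRep ρ) _ hr0 (uosCone_nonneg hr)).trans ?_
    have h1 : ‖w' 1‖ * (δ / (‖w' 1‖ + 1)) ≤ δ := by
      rw [mul_div_assoc', div_le_iff₀ (by positivity)]
      nlinarith [norm_nonneg (w' 1)]
    nlinarith [norm_nonneg (w' 1)]
  · refine le_trans ?_ (le_iSup_of_le 1 (le_iSup₂_of_le _ (uosNorm_single_le hΔ) le_rfl))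
    have h2 : (Matrix.of fun _ _ : Fin 1 => (Finsupp.single ⟨1, hΔ.one_mem⟩ 1 : SpanDelta Δ)).map
        (Finsupp.linearCombination ℂ w : SpanDelta Δ →ₗ[ℂ] (H →L[ℂ] H)) =
          Matrix.of fun _ _ => w' 1 := by
      refine Matrix.ext fun i j => ?_
      simp [← h]
    rw [h2, ← ofReal_norm, ← ofReal_norm]
    exact ENNReal.ofReal_le_ofReal (norm_blockOperator_one _)

theorem HasPositiveOperatorExtension.hasBoundedOperatorExtension (hΔ : IsPositivityDomain Δ)
    (h : HasPositiveOperatorExtension.{u, v} Δ) : HasBoundedOperatorExtension.{u, v} Δ := by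
  intro H _ _ _ w hw
  obtain ⟨w', h1, h2⟩ := h H w hw
  exact ⟨w', h1, h2, by rw [h1.fsNorm_eq, h1.fsNormOn_eq hΔ h2]⟩

end UOSNorm

/-! ## Operator functions from kernels -/

section Dilate

variable {Γ : Type u} [Group Γ] {H : Type v} [NormedAddCommGroup H] [InnerProductSpace ℂ H]
  [CompleteSpace H]

theorem inner_unitary_map_right {K : Type*} [NormedAddCommGroup K] [InnerProductSpace ℂ K]
    [CompleteSpace K] (ρ : Γ →* unitary (K →L[ℂ] K)) (s : Γ) (x y : K) :
    ⟪x, (ρ s : K →L[ℂ] K) y⟫_ℂ = ⟪(ρ s⁻¹ : K →L[ℂ] K) x, y⟫_ℂ := by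
  have h : (ρ s⁻¹ : K →L[ℂ] K) = ContinuousLinearMap.adjoint (ρ s : K →L[ℂ] K) := by
    rw [map_inv]
    rfl
  rw [h, ContinuousLinearMap.adjoint_inner_left]

/-- Compressions of unitary representations are positive semi-definite. -/
theorem isPosSemidef_compression {K : Type*} [NormedAddCommGroup K] [InnerProductSpace ℂ K]
    [CompleteSpace K] (ρ : Γ →* unitary (K →L[ℂ] K)) (V : H →L[ℂ] K) :
    IsPosSemidef fun s => ContinuousLinearMap.adjoint V ∘L (ρ s : K →L[ℂ] K) ∘L V := by
  refine isPosOn_univ_iff.1 ⟨fun s _ x y => ?_, fun F _ ξ => ?_⟩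
  · simp only [ContinuousLinearMap.comp_apply, ContinuousLinearMap.adjoint_inner_left,
      ContinuousLinearMap.adjoint_inner_right, inner_unitary_map_right ρ s]
  · have h : ∑ s ∈ F, ∑ t ∈ F,
        ⟪ξ s, (ContinuousLinearMap.adjoint V ∘L (ρ (s * t⁻¹) : K →L[ℂ] K) ∘L V) (ξ t)⟫_ℂ =
        ⟪∑ s ∈ F, (ρ s⁻¹ : K →L[ℂ] K) (V (ξ s)), ∑ s ∈ F, (ρ s⁻¹ : K →L[ℂ] K) (V (ξ s))⟫_ℂ := by
      rw [sum_inner]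
      refine Finset.sum_congr rfl fun s _ => ?_
      rw [inner_sum]
      refine Finset.sum_congr rfl fun t _ => ?_
      rw [ContinuousLinearMap.comp_apply, ContinuousLinearMap.comp_apply,
        ContinuousLinearMap.adjoint_inner_right, map_mul, Submonoid.coe_mul, mul_apply_eq_comp,
        inner_unitary_map_right ρ s]
    rw [h]
    exact inner_self_nonneg (𝕜 := ℂ)

/-- A kernel on `H` that is given by a bounded operator at the unit comes from a positive
semi-definite function. -/
theorem IsPosKernel.exists_isPosSemidef {k : Γ → H → H → ℂ} (hk : IsPosKernel k) {T : H →L[ℂ] H}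
    (hT : ∀ x y, k 1 x y = ⟪x, T y⟫_ℂ) :
    ∃ w : Γ → (H →L[ℂ] H), IsPosSemidef w ∧ ∀ s x y, ⟪x, w s y⟫_ℂ = k s x y := by
  obtain ⟨K, _, _, _, ρ, v, h⟩ := hk.exists_dilation
  have hv : ∀ x y, ⟪v x, v y⟫_ℂ = ⟪x, T y⟫_ℂ := fun x y => by
    rw [← hT, h, map_one]
    rfl
  -- So far v is only a function on H. Its Gram matrix is the sesquilinear form of T, so each defect
  -- of linearity is orthogonal to every v z; being a combination of such vectors, it is zero.
  have hadd : ∀ x y, v (x + y) = v x + v y := fun x y => by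
    have h1 : ∀ z, ⟪v z, v (x + y) - v x - v y⟫_ℂ = 0 := fun z => by
      simp [hv]
    have h2 : ⟪v (x + y) - v x - v y, v (x + y) - v x - v y⟫_ℂ = 0 := by
      conv_lhs => rw [inner_sub_left, inner_sub_left, h1, h1, h1]
      simp
    rw [inner_self_eq_zero, sub_sub, sub_eq_zero] at h2
    exact h2
  have hsmul : ∀ (c : ℂ) x, v (c • x) = c • v x := fun c x => by
    have h1 : ∀ z, ⟪v z, v (c • x) - c • v x⟫_ℂ = 0 := fun z => by
      simp [hv]
    have h2 : ⟪v (c • x) - c • v x, v (c • x) - c • v x⟫_ℂ = 0 := by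
      conv_lhs => rw [inner_sub_left, inner_smul_left, h1, h1]
      simp
    rwa [inner_self_eq_zero, sub_eq_zero] at h2
  have hbound : ∀ x, ‖v x‖ ≤ √‖T‖ * ‖x‖ := fun x => by
    refine abs_le_of_sq_le_sq' ?_ (by positivity) |>.2
    rw [mul_pow, Real.sq_sqrt (norm_nonneg _)]
    have h1 : ‖((‖v x‖ : ℂ)) ^ 2‖ = ‖v x‖ ^ 2 := by
      rw [norm_pow, Complex.norm_real, norm_norm]
    have h2 := hv x x
    rw [inner_self_eq_norm_sq_to_K] at h2
    calc ‖v x‖ ^ 2 = ‖((‖v x‖ : ℂ)) ^ 2‖ := h1.symm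
      _ = ‖⟪x, T x⟫_ℂ‖ := congrArg norm h2
      _ ≤ ‖x‖ * ‖T x‖ := norm_inner_le_norm _ _
      _ ≤ ‖x‖ * (‖T‖ * ‖x‖) := by gcongr; exact T.le_opNorm x
      _ = _ := by ring
  let V : H →L[ℂ] K := LinearMap.mkContinuous ⟨⟨v, hadd⟩, hsmul⟩ _ hbound
  refine ⟨_, isPosSemidef_compression ρ V, fun s x y => ?_⟩
  rw [h, ContinuousLinearMap.comp_apply, ContinuousLinearMap.adjoint_inner_right]
  rfl

end Dilate

/-! ## Complete factorisation implies the extension property -/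

section Extension

variable {Γ : Type u} [Group Γ] {H : Type v} [NormedAddCommGroup H] [InnerProductSpace ℂ H]

/-- The functional `x ↦ ∑ ⟪b_i, ψ(x_ij) b_j⟫` on matrices over `C⋆(Γ)`. -/
def pairing {m : Type} [Fintype m] (ψ : GroupCStar Γ →ₗ[ℂ] (H →L[ℂ] H)) (b : m → H) :
    MatCStar m Γ →ₗ[ℂ] ℂ where
  toFun x := ∑ i, ∑ j, ⟪b i, ψ (x i j) (b j)⟫_ℂ
  map_add' x y := by simp [Finset.sum_add_distrib]
  map_smul' c x := by simp [Finset.mul_sum]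

theorem pairing_tensorDelta {m : Type} [Fintype m] {ψ : GroupCStar Γ →ₗ[ℂ] (H →L[ℂ] H)}
    {g : Γ → (H →L[ℂ] H)} (hψ : ∀ s, ψ (delta s) = g s) (b : m → H) (A : Matrix m m ℂ) (s : Γ) :
    pairing ψ b (tensorDelta A s) = ∑ i, ∑ j, A i j * ⟪b i, g s (b j)⟫_ℂ := by
  simp [pairing, tensorDelta_apply, hψ]

theorem star_mem_supportedSubmodule {Δ : Set Γ} (hΔ : IsPositivityDomain Δ) {m : Type}
    {x : MatCStar m Γ} (hx : x ∈ supportedSubmodule m Δ) : star x ∈ supportedSubmodule m Δ := by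
  obtain ⟨F, hF, A, rfl⟩ := hx
  rw [star_sum]
  refine Submodule.sum_mem _ fun s hs => ?_
  rw [star_tensorDelta]
  exact tensorDelta_mem_supportedSubmodule _ (hΔ.inv_mem s (hF hs))

theorem pairing_star {Δ : Set Γ} {m : Type} [Fintype m] {ψ : GroupCStar Γ →ₗ[ℂ] (H →L[ℂ] H)}
    {g : Γ → (H →L[ℂ] H)} (hg : IsPosOn Δ g) (hψ : ∀ s, ψ (delta s) = g s) (b : m → H)
    {x : MatCStar m Γ} (hx : x ∈ supportedSubmodule m Δ) :
    pairing ψ b (star x) = conj (pairing ψ b x) := by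
  obtain ⟨F, hF, A, rfl⟩ := hx
  rw [star_sum, map_sum, map_sum, map_sum]
  refine Finset.sum_congr rfl fun s hs => ?_
  rw [star_tensorDelta, pairing_tensorDelta hψ, pairing_tensorDelta hψ, Finset.sum_comm]
  simp only [map_sum, map_mul, Matrix.conjTranspose_apply, inner_conj_symm]
  refine Finset.sum_congr rfl fun i _ => Finset.sum_congr rfl fun j _ => ?_
  have h1 : ⟪b j, g s⁻¹ (b i)⟫_ℂ = ⟪g s (b j), b i⟫_ℂ := by
    rw [← inner_conj_symm, hg.herm s (hF hs), inner_conj_symm]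
  rw [h1]
  rfl

/-- This is yy⋆ for the matrix y with a single nonzero column a. -/
theorem nonneg_mul_star {m : Type} [Fintype m] (a : m → GroupCStar Γ) :
    0 ≤ (CStarMatrix.ofMatrix (Matrix.of fun i j => a i * star (a j)) : MatCStar m Γ) := by
  classical
  rcases isEmpty_or_nonempty m with hm | ⟨⟨k⟩⟩
  · exact le_of_eq (CStarMatrix.ext fun i => hm.elim i)
  · let y : MatCStar m Γ := CStarMatrix.ofMatrix (Matrix.of fun i j => if j = k then a i else 0)
    convert mul_star_self_nonneg y using 1
    ext i j
    rw [CStarMatrix.mul_apply, Finset.sum_eq_single k]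
    · simp [y, CStarMatrix.star_apply]
    · intro l _ hl
      simp [y, hl]
    · simp

theorem coe_smul_nonneg {M : Type*} [CStarAlgebra M] [PartialOrder M] [StarOrderedRing M] {x : M}
    {t : ℝ} (ht : 0 ≤ t) (hx : 0 ≤ x) : 0 ≤ (t : ℂ) • x := by
  rw [Complex.coe_smul]
  exact smul_nonneg ht hx

variable {ι : Type w}

open scoped Classical in
/-- The finite submatrix of a finitely supported matrix over the group algebra, with index set
`ι`, along `b : m → ι`. -/
def compress {m : Type} (b : m → ι) : (Γ × ι × ι →₀ ℂ) →ₗ[ℂ] MatCStar m Γ :=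
  Finsupp.linearCombination ℂ fun p =>
    tensorDelta (Matrix.of fun i j => if p.2.1 = b i ∧ p.2.2 = b j then 1 else 0) p.1

/-- The matrices all of whose finite submatrices have positive real part. -/
def compressCone (Γ : Type u) [Group Γ] (ι : Type w) : PointedCone ℝ (Γ × ι × ι →₀ ℂ) where
  carrier := {x | ∀ (n : ℕ) (b : Fin n → ι), 0 ≤ compress b x + star (compress b x)}
  add_mem' := by
    intro x y hx hy n b
    have := add_nonneg (hx n b) (hy n b)
    rw [map_add, star_add]
    convert this using 1
    abel
  zero_mem' := by
    intro n b
    simp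
  smul_mem' := by
    rintro ⟨t, ht⟩ x hx n b
    have h1 : compress b ((⟨t, ht⟩ : {c : ℝ // 0 ≤ c}) • x) = (t : ℂ) • compress b x := by
      rw [← map_smul]
      rfl
    rw [h1, star_smul, Complex.star_def, Complex.conj_ofReal, ← smul_add]
    exact coe_smul_nonneg ht (hx n b)

theorem compress_single {m : Type} (b : m → ι) (p : Γ × ι × ι) (c : ℂ) (i j : m)
    [Decidable (p.2.1 = b i)] [Decidable (p.2.2 = b j)] :
    compress b (Finsupp.single p c) i j = if p.2.1 = b i ∧ p.2.2 = b j then c • delta p.1 else 0 := by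
  rw [compress, Finsupp.linearCombination_single, CStarMatrix.smul_apply, tensorDelta_apply]
  simp only [Matrix.of_apply]
  split_ifs <;> simp

/-- This is the cofinality hypothesis of the Riesz extension theorem, and the corrections can be
placed at the unit. For c at (s, i, j), the column with cδ_s at i and δ_1 at j (added if i = j) has
as its square the entry, its adjoint, |c|² at (i, i) and 1 at (j, j); halves appear because the cone
tests x + x⋆. -/
theorem compressCone_dense {Δ : Set Γ} (hΔ : IsPositivityDomain Δ) (y : Γ × ι × ι →₀ ℂ) :
    ∃ x ∈ Finsupp.supported ℂ ℂ {p : Γ × ι × ι | p.1 ∈ Δ}, x + y ∈ compressCone Γ ι := by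
  classical
  induction y using Finsupp.induction_linear with
  | zero => exact ⟨0, zero_mem _, by simp⟩
  | add y z hy hz =>
    obtain ⟨a, ha, ha'⟩ := hy
    obtain ⟨b, hb, hb'⟩ := hz
    refine ⟨a + b, add_mem ha hb, ?_⟩
    rw [add_add_add_comm]
    exact add_mem ha' hb'
  | single p c =>
    obtain ⟨s, i, j⟩ := p
    refine ⟨Finsupp.single (1, i, i) (c * conj c / 2) + Finsupp.single (1, j, j) (1 / 2),
      add_mem (Finsupp.single_mem_supported _ _ hΔ.one_mem)
        (Finsupp.single_mem_supported _ _ hΔ.one_mem), fun n b => ?_⟩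
    convert nonneg_mul_star fun k => (if i = b k then c else 0) • delta s +
      (if j = b k then (1 : ℂ) else 0) • delta (1 : Γ) using 1
    ext k l
    simp only [map_add, star_add, CStarMatrix.add_apply, CStarMatrix.star_apply, compress_single,
      CStarMatrix.ofMatrix_apply, Matrix.of_apply, star_smul, mul_add, add_mul,
      smul_mul_smul_comm, star_delta, delta_mul, inv_one, mul_one, one_mul, mul_inv_cancel]
    simp only [ite_and]
    split_ifs <;> simp [star_delta] <;> module

end Extension

/-! ### The operator functional on matrices over Δ and its positive extension -/

section Extension

variable {Γ : Type u} [Group Γ] {H : Type v} [NormedAddCommGroup H] [InnerProductSpace ℂ H]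

theorem compress_mem_supportedSubmodule {ι : Type w} {Δ : Set Γ} {m : Type} (b : m → ι)
    {x : Γ × ι × ι →₀ ℂ} (hx : x ∈ Finsupp.supported ℂ ℂ {p : Γ × ι × ι | p.1 ∈ Δ}) :
    compress b x ∈ supportedSubmodule m Δ := by
  rw [compress, Finsupp.linearCombination_apply]
  exact Submodule.sum_mem _ fun p hp => Submodule.smul_mem _ _
    (tensorDelta_mem_supportedSubmodule _ (hx hp))

/-- The functional on finitely supported matrices over the group algebra given by an operator
valued function. -/
def operatorFunctional (g : Γ → (H →L[ℂ] H)) : (Γ × H × H →₀ ℂ) →ₗ[ℂ] ℂ :=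
  Finsupp.linearCombination ℂ fun p => ⟪p.2.1, g p.1 p.2.2⟫_ℂ

/-- Injectivity of b ensures that each coefficient of x appears in exactly one matrix entry. -/
theorem pairing_compress {m : Type} [Fintype m] {ψ : GroupCStar Γ →ₗ[ℂ] (H →L[ℂ] H)}
    {g : Γ → (H →L[ℂ] H)} (hψ : ∀ s, ψ (delta s) = g s) {b : m → H} (hb : Function.Injective b)
    {x : Γ × H × H →₀ ℂ}
    (hx : ∀ p ∈ x.support, p.2.1 ∈ Set.range b ∧ p.2.2 ∈ Set.range b) :
    pairing ψ b (compress b x) = operatorFunctional g x := by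
  classical
  rw [compress, operatorFunctional, Finsupp.linearCombination_apply,
    Finsupp.linearCombination_apply, Finsupp.sum, map_sum]
  refine Finset.sum_congr rfl fun p hp => ?_
  obtain ⟨⟨i, hi⟩, ⟨j, hj⟩⟩ := hx p hp
  rw [map_smul, pairing_tensorDelta hψ, Finset.sum_eq_single i, Finset.sum_eq_single j]
  · simp [hi, hj]
  · intro l _ hl
    have : ¬ p.2.2 = b l := fun h => hl (hb (h.symm.trans hj.symm))
    simp [this]
  · simp
  · intro l _ hl
    have : ¬ p.2.1 = b l := fun h => hl (hb (h.symm.trans hi.symm))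
    simp [this]
  · simp

/-- Compress x along the finitely many vectors in its support. Twice the real part of the result is
positive and supported in `Δ`, hence a sum of squares after adding ε1; pair with g and let ε tend to
0. -/
theorem HasCompleteFactorisation.operatorFunctional_nonneg {Δ : Set Γ} (hΔ : IsPositivityDomain Δ)
    (h : HasCompleteFactorisation Δ) {g : Γ → (H →L[ℂ] H)} (hg : IsPosOn Δ g)
    {x : Γ × H × H →₀ ℂ} (hx : x ∈ Finsupp.supported ℂ ℂ {p : Γ × H × H | p.1 ∈ Δ})
    (hx' : x ∈ compressCone Γ H) : 0 ≤ (operatorFunctional g x).re := by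
  classical
  obtain ⟨ψ, hψ⟩ := exists_linearMap_delta g
  let I : Finset H := x.support.image (fun p => p.2.1) ∪ x.support.image fun p => p.2.2
  let b : Fin I.card → H := fun k => I.equivFin.symm k
  have hb : Function.Injective b := Subtype.val_injective.comp I.equivFin.symm.injective
  have hbr : ∀ y ∈ I, y ∈ Set.range b := fun y hy => ⟨I.equivFin ⟨y, hy⟩, by simp [b]⟩
  have hpair : pairing ψ b (compress b x) = operatorFunctional g x :=
    pairing_compress hψ hb fun p hp =>
      ⟨hbr _ (Finset.mem_union_left _ (Finset.mem_image_of_mem _ hp)),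
        hbr _ (Finset.mem_union_right _ (Finset.mem_image_of_mem _ hp))⟩
  have hmem := compress_mem_supportedSubmodule b hx
  have h1 : ∀ ε : ℝ, 0 < ε →
      0 ≤ 2 * (operatorFunctional g x).re + ε * (pairing ψ b 1).re := fun ε hε => by
    have h2 := (h _ _ (hx' _ b) (add_mem hmem (star_mem_supportedSubmodule hΔ hmem)) ε
      hε).re_sum_nonneg hg hψ b
    have h3 : 0 ≤ (pairing ψ b (compress b x + star (compress b x) +
      (ε : ℂ) • (1 : MatCStar (Fin I.card) Γ))).re := h2
    rw [map_add, map_add, map_smul, pairing_star hg hψ b hmem, hpair, smul_eq_mul, Complex.add_re,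
      Complex.add_re, Complex.conj_re, Complex.re_ofReal_mul] at h3
    linarith
  have h2 : Filter.Tendsto
      (fun ε : ℝ => 2 * (operatorFunctional g x).re + ε * (pairing ψ b 1).re)
      (nhdsWithin 0 (Set.Ioi 0))
      (nhds (2 * (operatorFunctional g x).re + 0 * (pairing ψ b 1).re)) := by
    refine Filter.Tendsto.mono_left ?_ nhdsWithin_le_nhds
    refine Continuous.tendsto ?_ 0
    fun_prop
  have h3 := ge_of_tendsto h2 (Filter.eventually_of_mem self_mem_nhdsWithin h1)
  linarith

/-- Real functionals that are positive on `compressCone` define positive semi-definite kernels. -/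
theorem isPosKernel_of_nonneg {ι : Type w} (G : (Γ × ι × ι →₀ ℂ) →ₗ[ℝ] ℝ)
    (hG : ∀ x ∈ compressCone Γ ι, 0 ≤ G x) :
    IsPosKernel fun s i j => (G (Finsupp.single (s, i, j) 1) : ℂ) -
      G (Finsupp.single (s, i, j) Complex.I) * Complex.I := by
  classical
  -- If every compression of x is skew-adjoint, then both x and -x lie in the cone. This gives the
  -- Hermitian symmetry of the kernel.
  have hanti : ∀ x : Γ × ι × ι →₀ ℂ,
      (∀ (n : ℕ) (b : Fin n → ι), compress b x + star (compress b x) = 0) → G x = 0 := fun x hx => by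
    refine le_antisymm ?_ (hG x fun n b => (hx n b).ge)
    have := hG (-x) fun n b => by
      rw [map_neg, star_neg, ← neg_add, hx, neg_zero]
    rw [map_neg] at this
    linarith
  refine ⟨fun s i j => ?_, fun c => ?_⟩
  · have h1 : G (Finsupp.single (s⁻¹, j, i) 1 - Finsupp.single (s, i, j) 1) = 0 := by
      refine hanti _ fun n b => ?_
      ext k l
      simp only [map_sub, star_sub, CStarMatrix.add_apply, CStarMatrix.sub_apply,
        CStarMatrix.star_apply, compress_single, CStarMatrix.zero_apply, ite_and]
      split_ifs <;> simp [star_delta]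
    have h2 : G (Finsupp.single (s⁻¹, j, i) Complex.I + Finsupp.single (s, i, j) Complex.I) = 0 := by
      refine hanti _ fun n b => ?_
      ext k l
      simp only [map_add, star_add, CStarMatrix.add_apply,
        CStarMatrix.star_apply, compress_single, CStarMatrix.zero_apply, ite_and]
      split_ifs <;> simp [star_delta]
    rw [map_sub, sub_eq_zero] at h1
    rw [map_add, ← eq_neg_iff_add_eq_zero] at h2
    simp only [h1, h2, map_sub, map_mul, Complex.conj_ofReal, Complex.conj_I]
    push_cast
    ring
  -- Every compression of q is a column times its adjoint, so q lies in the cone; G(q) is the real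
  -- part of the quadratic form of the kernel at c.
  · let q : Γ × ι × ι →₀ ℂ := c.sum fun p a => c.sum fun p' a' =>
      Finsupp.single (p.1 * p'.1⁻¹, p.2, p'.2) (conj a * a')
    have hq : q ∈ compressCone Γ ι := fun n b => by
      have h1 : compress b q = CStarMatrix.ofMatrix (Matrix.of fun k l =>
          (c.sum fun p a => if p.2 = b k then conj a • delta p.1 else 0) *
            star (c.sum fun p a => if p.2 = b l then conj a • delta p.1 else 0)) := by
        ext k l
        simp only [q, Finsupp.sum, map_sum, sum_mat_apply, compress_single, CStarMatrix.ofMatrix_apply,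
          Matrix.of_apply, star_sum, Finset.sum_mul_sum]
        refine Finset.sum_congr rfl fun p _ => Finset.sum_congr rfl fun p' _ => ?_
        simp only [ite_and]
        split_ifs <;> simp [star_delta, delta_mul, smul_smul, mul_comm]
      rw [h1]
      have h2 := nonneg_mul_star fun k => c.sum fun p a => if p.2 = b k then conj a • delta p.1 else 0
      exact add_nonneg h2 (star_nonneg_iff.2 h2)
    have h3 := hG q hq
    convert h3 using 1
    -- G is only real linear: G(1) - iG(i) is the coefficient of the complex linear functional whose
    -- real part is G.
    have hG1 : ∀ p (z : ℂ), G (Finsupp.single p z) =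
        (z * ((G (Finsupp.single p 1) : ℂ) - G (Finsupp.single p Complex.I) * Complex.I)).re :=
      fun p z => by
        have : (Finsupp.single p z : Γ × ι × ι →₀ ℂ) =
            z.re • Finsupp.single p 1 + z.im • Finsupp.single p Complex.I := by
          rw [Finsupp.smul_single, Finsupp.smul_single, ← Finsupp.single_add]
          congr 1
          simp
        rw [this, map_add, map_smul, map_smul]
        simp
    simp only [kernelForm, q, Finsupp.sum, map_sum, Complex.re_sum]
    exact Finset.sum_congr rfl fun p _ => Finset.sum_congr rfl fun p' _ => (hG1 _ _).symm

theorem HasCompleteFactorisation.hasPositiveOperatorExtension {Δ : Set Γ}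
    (hΔ : IsPositivityDomain Δ) (h : HasCompleteFactorisation Δ) :
    HasPositiveOperatorExtension.{u, v} Δ := by
  classical
  intro H _ _ _ w hw
  -- The values off `Δ` play no role: g is tested on quotients of admissible sets and on elements
  -- supported in `Δ`.
  let g : Γ → (H →L[ℂ] H) := fun s => if hs : s ∈ Δ then w ⟨s, hs⟩ else 0
  have hgw : ∀ s : Δ, g s = w s := fun s => by simp [g]
  have hg : IsPosOn Δ g := (isPosSemidefOn_iff hΔ hgw).1 hw
  let D : Submodule ℝ (Γ × H × H →₀ ℂ) :=
    (Finsupp.supported ℂ ℂ {p : Γ × H × H | p.1 ∈ Δ}).restrictScalars ℝ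
  let f : (Γ × H × H →₀ ℂ) →ₗ.[ℝ] ℝ :=
    ⟨D, (Complex.reLm ∘ₗ (operatorFunctional g).restrictScalars ℝ).domRestrict D⟩
  obtain ⟨G, hGf, hG⟩ := riesz_extension (compressCone Γ H) f
    (fun x hx => h.operatorFunctional_nonneg hΔ hg x.2 hx) fun y => by
      obtain ⟨x, hx, hxy⟩ := compressCone_dense hΔ y
      exact ⟨⟨x, hx⟩, hxy⟩
  have hGs : ∀ s ∈ Δ, ∀ x y c, G (Finsupp.single (s, x, y) c) = (c * ⟪x, g s y⟫_ℂ).re :=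
    fun s hs x y c => by
      have := hGf ⟨Finsupp.single (s, x, y) c, Finsupp.single_mem_supported _ _ hs⟩
      rw [this]
      change (operatorFunctional g (Finsupp.single (s, x, y) c)).re = _
      simp [operatorFunctional]
  have hks : ∀ s ∈ Δ, ∀ x y, (G (Finsupp.single (s, x, y) 1) : ℂ) -
      G (Finsupp.single (s, x, y) Complex.I) * Complex.I = ⟪x, g s y⟫_ℂ := fun s hs x y => by
    rw [hGs s hs, hGs s hs]
    apply Complex.ext <;> simp
  obtain ⟨w', hw', hw'k⟩ := (isPosKernel_of_nonneg G hG).exists_isPosSemidef (T := g 1)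
    (hks 1 hΔ.one_mem)
  refine ⟨w', hw', fun s => ?_⟩
  rw [← hgw]
  refine ContinuousLinearMap.ext fun y => ext_inner_left ℂ fun x => ?_
  rw [hw'k, hks s s.2]

end Extension

/-! ## The extension property implies complete factorisation -/

/-- Separation of a point from a convex cone with an order unit. -/
theorem exists_separating_functional {E : Type*} [AddCommGroup E] [Module ℝ E]
    (C : PointedCone ℝ E) {e : E} (he : ∀ x, ∃ r : ℝ, r • e + x ∈ C) (heC : e ∈ C) {z : E}
    (hz : z ∉ C) : ∃ f : E →ₗ[ℝ] ℝ, (∀ x ∈ C, 0 ≤ f x) ∧ f e = 1 ∧ f z ≤ 0 := by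
  have hsmul : ∀ {t : ℝ} {x : E}, 0 ≤ t → x ∈ C → t • x ∈ C := fun {t x} ht hx =>
    C.smul_mem ht hx
  have he0 : e ≠ 0 := fun h0 => hz (by simpa [h0] using he z)
  -- If -e were in C, the order unit property would put every element, including z, into C.
  have hneC : -e ∉ C := fun h => by
    obtain ⟨r, hr⟩ := he z
    have h1 := add_mem hr (hsmul (abs_nonneg r) h)
    have h2 := add_mem h1 (hsmul (sub_nonneg.2 (le_abs_self r)) heC)
    exact hz (by convert h2 using 1; module)
  -- Adjoining -z forces any functional positive on the larger cone to be nonpositive at z. The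
  -- larger cone still omits -e, so te ↦ t is positive on its intersection with the line through e
  -- and extends by the Riesz theorem.
  let C' : PointedCone ℝ E := C ⊔ Submodule.span _ {-z}
  have hC' : ∀ x ∈ C', ∃ c ∈ C, ∃ t : ℝ, 0 ≤ t ∧ x = c - t • z := fun x hx => by
    obtain ⟨c, hc, d, hd, rfl⟩ := Submodule.mem_sup.1 hx
    obtain ⟨⟨t, ht⟩, rfl⟩ := Submodule.mem_span_singleton.1 hd
    refine ⟨c, hc, t, ht, ?_⟩
    change c + t • -z = _
    module
  have hne : -e ∉ C' := fun h => by
    obtain ⟨c, hc, t, ht, h1⟩ := hC' _ h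
    rcases ht.eq_or_lt with h0 | h0
    · rw [← h0, zero_smul, sub_zero] at h1
      exact hneC (h1 ▸ hc)
    · have h2 : z = t⁻¹ • (e + c) := by
        have : t • z = e + c := by
          rw [eq_sub_iff_add_eq, neg_add_eq_iff_eq_add] at h1
          exact h1
        rw [← this, smul_smul, inv_mul_cancel₀ h0.ne', one_smul]
      exact hz (h2 ▸ hsmul (inv_nonneg.2 ht) (add_mem heC hc))
  have hCC' : C ≤ C' := le_sup_left
  let f : E →ₗ.[ℝ] ℝ := LinearPMap.mkSpanSingleton e 1 he0
  have hf : ∀ x : f.domain, (x : E) ∈ C' → 0 ≤ f x := by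
    rintro ⟨x, hx'⟩ hx
    obtain ⟨t, rfl⟩ := Submodule.mem_span_singleton.1 hx'
    have h1 : f ⟨t • e, hx'⟩ = t • 1 := LinearPMap.mkSpanSingleton'_apply e (1 : ℝ) _ t hx'
    rw [h1, smul_eq_mul, mul_one]
    by_contra! ht
    refine hne ?_
    have h2 := C'.smul_mem (inv_nonneg.2 (neg_nonneg.2 ht.le)) hx
    convert h2 using 1
    change -e = (-t)⁻¹ • (t • e)
    rw [smul_smul, inv_neg, neg_mul, inv_mul_cancel₀ ht.ne, neg_one_smul]
  obtain ⟨g, hgf, hg⟩ := riesz_extension C' f hf fun y => by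
    obtain ⟨r, hr⟩ := he y
    exact ⟨⟨r • e, Submodule.smul_mem _ _ (Submodule.mem_span_singleton_self e)⟩, hCC' hr⟩
  refine ⟨g, fun x hx => hg x (hCC' hx), ?_, ?_⟩
  · rw [hgf ⟨e, Submodule.mem_span_singleton_self e⟩]
    exact LinearPMap.mkSpanSingleton_apply ℝ ℝ he0 1
  · have h1 : -z ∈ C' := Submodule.mem_sup_right (Submodule.mem_span_singleton_self _)
    have h2 := hg _ h1
    rw [map_neg] at h2
    linarith

section Factorisation

variable {Γ : Type u} {m : Type}

/-- The element `A ⊗ s` as a finitely supported matrix over the group algebra. -/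
def matrixSingle [Fintype m] (A : Matrix m m ℂ) (s : Γ) : Γ × m × m →₀ ℂ :=
  ∑ i, ∑ j, Finsupp.single (s, i, j) (A i j)

/-- The matrix coefficients of the complex functional with real part `G`. -/
def functionalKernel (G : (Γ × m × m →₀ ℂ) →ₗ[ℝ] ℝ) (s : Γ) : Matrix m m ℂ :=
  Matrix.of fun i j => (G (Finsupp.single (s, i, j) 1) : ℂ) -
    G (Finsupp.single (s, i, j) Complex.I) * Complex.I

theorem apply_matrixSingle [Fintype m] (G : (Γ × m × m →₀ ℂ) →ₗ[ℝ] ℝ) (A : Matrix m m ℂ) (s : Γ) :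
    G (matrixSingle A s) = (∑ i, ∑ j, A i j * functionalKernel G s i j).re := by
  simp only [matrixSingle, map_sum, Complex.re_sum]
  refine Finset.sum_congr rfl fun i _ => Finset.sum_congr rfl fun j _ => ?_
  have : (Finsupp.single (s, i, j) (A i j) : Γ × m × m →₀ ℂ) =
      (A i j).re • Finsupp.single (s, i, j) 1 + (A i j).im • Finsupp.single (s, i, j) Complex.I := by
    rw [Finsupp.smul_single, Finsupp.smul_single, ← Finsupp.single_add]
    congr 1
    simp
  rw [this, map_add, map_smul, map_smul, functionalKernel]
  simp

variable [Group Γ] [DecidableEq m]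

open scoped Classical in
/-- The map from finitely supported matrices over the group algebra to matrices over `C⋆(Γ)` that
forgets the coefficients outside `Δ`. -/
def truncate (Δ : Set Γ) : (Γ × m × m →₀ ℂ) →ₗ[ℂ] MatCStar m Γ :=
  Finsupp.linearCombination ℂ fun p =>
    if p.1 ∈ Δ then tensorDelta (Matrix.single p.2.1 p.2.2 1) p.1 else 0

theorem truncate_matrixSingle [Fintype m] {Δ : Set Γ} (A : Matrix m m ℂ) {s : Γ} (hs : s ∈ Δ) :
    truncate Δ (matrixSingle A s) = tensorDelta A s := by
  have h : A = ∑ i, ∑ j, A i j • Matrix.single i j (1 : ℂ) := by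
    conv_lhs => rw [Matrix.matrix_eq_sum_single A]
    simp [Matrix.smul_single]
  let T : Matrix m m ℂ →ₗ[ℂ] MatCStar m Γ :=
    ⟨⟨fun A => tensorDelta A s, fun A B => tensorDelta_add A B s⟩, fun c A => tensorDelta_smul c A s⟩
  change _ = T A
  conv_rhs => rw [h]
  simp only [map_sum, map_smul, truncate, matrixSingle, Finsupp.linearCombination_single, hs, if_true]
  rfl

theorem truncate_mem {Δ : Set Γ} (x : Γ × m × m →₀ ℂ) : truncate Δ x ∈ supportedSubmodule m Δ := by
  classical
  rw [truncate, Finsupp.linearCombination_apply]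
  refine Submodule.sum_mem _ fun p _ => Submodule.smul_mem _ _ ?_
  split_ifs with h
  · exact tensorDelta_mem_supportedSubmodule _ h
  · exact zero_mem _

/-- The matrices whose truncation has a sum of squares as its real part. -/
def sumOfSquaresCone [Fintype m] (Δ : Set Γ) : PointedCone ℝ (Γ × m × m →₀ ℂ) where
  carrier := {x | IsSumOfSquares Δ (truncate Δ x + star (truncate Δ x))}
  add_mem' := by
    intro x y hx hy
    have := IsSumOfSquares.add hx hy
    rw [add_add_add_comm, ← star_add, ← map_add] at this
    exact this
  zero_mem' := by simpa using isSumOfSquares_zero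
  smul_mem' := by
    rintro ⟨t, ht⟩ x hx
    have h1 : truncate Δ ((⟨t, ht⟩ : {c : ℝ // 0 ≤ c}) • x) = (t : ℂ) • truncate Δ x := by
      rw [← map_smul]
      rfl
    change IsSumOfSquares Δ _
    rw [h1, star_smul, Complex.star_def, Complex.conj_ofReal, ← smul_add]
    exact IsSumOfSquares.smul hx ht

/-- Truncation is what makes this true on the whole space: coefficients outside `Δ`, which sums of
squares could not absorb, are discarded. -/
theorem sumOfSquaresCone_orderUnit [Fintype m] {Δ : Set Γ} (hΔ : IsPositivityDomain Δ)
    (x : Γ × m × m →₀ ℂ) : ∃ r : ℝ, r • matrixSingle 1 1 + x ∈ sumOfSquaresCone Δ := by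
  obtain ⟨r, hr, h⟩ := exists_isSumOfSquares_add hΔ (truncate_mem (Δ := Δ) x)
  refine ⟨r / 2, ?_⟩
  change IsSumOfSquares Δ _
  convert h using 1
  rw [map_add, ← Complex.coe_smul, map_smul, truncate_matrixSingle _ hΔ.one_mem, tensorDelta_one,
    star_add, star_smul, star_one, Complex.star_def, Complex.conj_ofReal, add_add_add_comm,
    ← add_smul, ← Complex.ofReal_add, add_halves]

/-- If the truncation of x is skew-adjoint, then x and -x both lie in the cone, so G vanishes at x.
-/
theorem functionalKernel_herm [Fintype m] {Δ : Set Γ} (hΔ : IsPositivityDomain Δ)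
    {G : (Γ × m × m →₀ ℂ) →ₗ[ℝ] ℝ} (hG : ∀ x ∈ sumOfSquaresCone Δ, 0 ≤ G x) {s : Γ} (hs : s ∈ Δ) :
    functionalKernel G s⁻¹ = (functionalKernel G s).conjTranspose := by
  have hanti : ∀ x : Γ × m × m →₀ ℂ, truncate Δ x + star (truncate Δ x) = 0 → G x = 0 :=
    fun x hx => by
      refine le_antisymm ?_ (hG x ?_)
      · have := hG (-x) (by
          change IsSumOfSquares Δ _
          rw [map_neg, star_neg, ← neg_add, hx, neg_zero]
          exact isSumOfSquares_zero)
        rw [map_neg] at this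
        linarith
      · change IsSumOfSquares Δ _
        rw [hx]
        exact isSumOfSquares_zero
  ext j i
  have h1 : G (Finsupp.single (s⁻¹, j, i) 1 - Finsupp.single (s, i, j) 1) = 0 := by
    refine hanti _ ?_
    simp [truncate, hs, hΔ.inv_mem s hs, star_tensorDelta]
  have h2 : G (Finsupp.single (s⁻¹, j, i) Complex.I + Finsupp.single (s, i, j) Complex.I) = 0 := by
    refine hanti _ ?_
    simp [truncate, hs, hΔ.inv_mem s hs, star_tensorDelta]
  rw [map_sub, sub_eq_zero] at h1
  rw [map_add, ← eq_neg_iff_add_eq_zero] at h2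
  simp [functionalKernel, h1, h2]

theorem inner_toEuclideanCLM {κ : Type*} [Fintype κ] [DecidableEq κ] (M : Matrix κ κ ℂ)
    (x y : EuclideanSpace ℂ κ) :
    ⟪x, Matrix.toEuclideanCLM (𝕜 := ℂ) M y⟫_ℂ = ∑ i, ∑ j, conj (x i) * y j * M i j := by
  simp only [PiLp.inner_apply, Matrix.ofLp_toEuclideanCLM, Matrix.mulVec, dotProduct, inner_sum]
  refine Finset.sum_congr rfl fun i _ => Finset.sum_congr rfl fun j _ => ?_
  simp
  ring

theorem isPosOn_functionalKernel [Fintype m] [Nonempty m] {Δ : Set Γ} (hΔ : IsPositivityDomain Δ)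
    {G : (Γ × m × m →₀ ℂ) →ₗ[ℝ] ℝ} (hG : ∀ x ∈ sumOfSquaresCone Δ, 0 ≤ G x) {κ : Type*} [Fintype κ]
    [DecidableEq κ] (e : m ≃ κ) :
    IsPosOn Δ fun s => Matrix.toEuclideanCLM (𝕜 := ℂ) ((functionalKernel G s).reindex e e) := by
  refine ⟨fun s hs x y => ?_, fun F hF ξ => ?_⟩
  · rw [← inner_conj_symm, inner_toEuclideanCLM, inner_toEuclideanCLM, functionalKernel_herm hΔ hG hs,
      Finset.sum_comm]
    simp only [map_sum, map_mul, Complex.conj_conj]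
    refine Finset.sum_congr rfl fun i _ => Finset.sum_congr rfl fun j _ => ?_
    simp only [Matrix.reindex_apply, Matrix.submatrix_apply, Matrix.conjTranspose_apply,
      Complex.star_def, Complex.conj_conj]
    ring
  · obtain ⟨k⟩ := ‹Nonempty m›
    -- A s carries conj(ξ s) in the single column k, so A_s A_t⋆ has entries conj(ξ_s(i)) ξ_t(j),
    -- and the quadratic form becomes G at the square of ∑ A_s ⊗ δ_s.
    let A : Γ → Matrix m m ℂ := fun s => Matrix.of fun i j => if j = k then conj (ξ s (e i)) else 0
    have hA : ∀ s t i j, (A s * (A t).conjTranspose) i j = conj (ξ s (e i)) * ξ t (e j) :=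
      fun s t i j => by
        rw [Matrix.mul_apply, Finset.sum_eq_single k (fun l _ hl => by simp [A, hl]) (by simp)]
        simp [A]
    have h1 : (∑ s ∈ F, ∑ t ∈ F, ⟪ξ s, Matrix.toEuclideanCLM (𝕜 := ℂ)
        ((functionalKernel G (s * t⁻¹)).reindex e e) (ξ t)⟫_ℂ).re =
        G (∑ s ∈ F, ∑ t ∈ F, matrixSingle (A s * (A t).conjTranspose) (s * t⁻¹)) := by
      simp only [map_sum, Complex.re_sum, apply_matrixSingle, inner_toEuclideanCLM, hA]
      refine Finset.sum_congr rfl fun s _ => Finset.sum_congr rfl fun t _ => ?_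
      rw [← Equiv.sum_comp e]
      refine Finset.sum_congr rfl fun i _ => ?_
      rw [← Equiv.sum_comp e]
      simp
    rw [h1]
    refine hG _ ?_
    have h2 : truncate Δ (∑ s ∈ F, ∑ t ∈ F, matrixSingle (A s * (A t).conjTranspose) (s * t⁻¹)) =
        (∑ s ∈ F, tensorDelta (A s) s) * star (∑ s ∈ F, tensorDelta (A s) s) := by
      rw [star_sum, Finset.sum_mul_sum, map_sum]
      refine Finset.sum_congr rfl fun s hs => ?_
      rw [map_sum]
      refine Finset.sum_congr rfl fun t ht => ?_
      rw [truncate_matrixSingle _ (hF s hs t ht), star_tensorDelta, tensorDelta_mul]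
    have h3 := isSumOfSquares_mul_star hF (y := ∑ s ∈ F, tensorDelta (A s) s) ⟨A, rfl⟩
    change IsSumOfSquares Δ _
    rw [h2, star_mul, star_star]
    exact h3.add h3

theorem HasPositiveOperatorExtension.hasCompleteFactorisation {Δ : Set Γ}
    (hΔ : IsPositivityDomain Δ) (h : HasPositiveOperatorExtension.{u, v} Δ) :
    HasCompleteFactorisation Δ := by
  intro n z hz hzF ε hε
  rcases n.eq_zero_or_pos with rfl | hn
  · rw [show z + (ε : ℂ) • (1 : MatCStar (Fin 0) Γ) = 0 from CStarMatrix.ext fun i => i.elim0]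
    exact isSumOfSquares_zero
  have : Nonempty (Fin n) := ⟨⟨0, hn⟩⟩
  obtain ⟨F, hF, A, hA⟩ := hzF
  by_contra hnot
  let z' : Γ × Fin n × Fin n →₀ ℂ := ∑ s ∈ F, matrixSingle (A s) s
  have hz' : truncate Δ z' = z := by
    rw [hA, map_sum]
    exact Finset.sum_congr rfl fun s hs => truncate_matrixSingle _ (hF hs)
  have hone : truncate Δ (matrixSingle (1 : Matrix (Fin n) (Fin n) ℂ) (1 : Γ)) = 1 := by
    rw [truncate_matrixSingle _ hΔ.one_mem, tensorDelta_one]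
  obtain ⟨G, hG, hG1, hGz⟩ := exists_separating_functional (sumOfSquaresCone Δ)
    (sumOfSquaresCone_orderUnit hΔ) (e := matrixSingle 1 1) (z := z' + ε • matrixSingle 1 1)
    (by
      change IsSumOfSquares Δ _
      rw [hone, star_one]
      exact (isSumOfSquares_one hΔ).add (isSumOfSquares_one hΔ))
    -- As z is self-adjoint, the truncation plus its adjoint is 2(z + ε1); hence the factor 1/2.
    (fun hmem => hnot (by
      have h1 : IsSumOfSquares Δ (_ + star _) := hmem
      have h2 := h1.smul (t := 1 / 2) (by norm_num)
      convert h2 using 1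
      rw [map_add, hz', ← Complex.coe_smul, map_smul, hone, star_add, star_smul, star_one,
        Complex.star_def, Complex.conj_ofReal, (IsSelfAdjoint.of_nonneg hz).star_eq, ← two_smul ℂ,
        smul_smul]
      norm_num))
  -- The lift places the n-dimensional Hilbert space in the universe over which the extension
  -- property quantifies.
  let e : Fin n ≃ ULift.{v} (Fin n) := Equiv.ulift.symm
  let g : Γ → (EuclideanSpace ℂ (ULift.{v} (Fin n)) →L[ℂ] EuclideanSpace ℂ (ULift.{v} (Fin n))) :=
    fun s => Matrix.toEuclideanCLM (𝕜 := ℂ) ((functionalKernel G s).reindex e e)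
  have hg : IsPosOn Δ g := isPosOn_functionalKernel hΔ hG e
  obtain ⟨w', hw', hw'g⟩ := h _ (fun s : Δ => g s) ((isPosSemidefOn_iff hΔ fun _ => rfl).2 hg)
  obtain ⟨φ, hφ⟩ := hw'.exists_clm
  let b : Fin n → EuclideanSpace ℂ (ULift.{v} (Fin n)) := fun i => EuclideanSpace.single (e i) 1
  have h1 : 0 ≤ (pairing φ.toLinearMap b z).re := hw'.re_sum_nonneg hφ hz b
  have hb : ∀ s i j, ⟪b i, g s (b j)⟫_ℂ = functionalKernel G s i j := fun s i j => by
    rw [inner_toEuclideanCLM, Finset.sum_eq_single (e i) (fun l _ hl => by simp [b, hl]) (by simp),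
      Finset.sum_eq_single (e j) (fun l _ hl => by simp [b, hl]) (by simp)]
    simp [b]
  have h2 : (pairing φ.toLinearMap b z).re = G z' := by
    rw [hA, map_sum, map_sum, Complex.re_sum]
    refine Finset.sum_congr rfl fun s hs => ?_
    rw [pairing_tensorDelta (g := w') hφ, apply_matrixSingle, hw'g ⟨s, hF hs⟩]
    simp only [hb]
  -- Separation gives G(z') ≤ -ε, while the extended function gives G(z') ≥ 0.
  rw [map_add, map_smul, hG1, smul_eq_mul, mul_one] at hGz
  linarith

end Factorisation

end PosDomain

end

theorem mainTheorem2 {Γ : Type u} [Group Γ] (Δ : Set Γ) (hΔ : PosDomain.IsPositivityDomain Δ) :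
    List.TFAE [
      PosDomain.HasPositiveOperatorExtension.{u, v} Δ,
      PosDomain.HasBoundedOperatorExtension.{u, v} Δ,
      PosDomain.HasCompleteFactorisation Δ] := by
  tfae_have 1 → 2 := fun h => h.hasBoundedOperatorExtension hΔ
  tfae_have 2 → 1 := fun h H _ _ _ w hw =>
    let ⟨w', h1, h2, _⟩ := h H w hw
    ⟨w', h1, h2⟩
  tfae_have 1 → 3 := fun h => h.hasCompleteFactorisation hΔ
  tfae_have 3 → 1 := fun h => h.hasPositiveOperatorExtension hΔ
  tfae_finish
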